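/- Let $\mathbb K$ be an algebraically closed field, $V$ a $\mathbb K$-vector space of finite positive dimension, $I$ the identity of $V$, and $d\ge 1$. A *tridiagonal pair* on $V$ is an ordered pair $A,A^*\in\mathrm{End}(V)$ such that both are diagonalizable; the eigenspaces of $A$ can be ordered $V_0,\dots,V_d$ with $A^*V_i\subseteq V_{i-1}+V_i+V_{i+1}$ for all $i$ (where $V_{-1}=V_{d+1}=0$); likewise with the roles of $A$ and $A^*$ exchanged (with an ordering $V^*_0,\dots,V^*_\delta$); and no subspace $W\ne 0,V$ satisfies $AW\subseteq W$ and $A^*W\subseteq W$. Such orderings of the eigenspaces, and the corresponding orderings of the primitive idempotents (the projections onto the eigenspaces), are called *standard*. Let $\Phi=(A;\{E_i\}_{i=0}^d;A^*;\{E^*_i\}_{i=0}^d)$ be a tridiagonal system on $V$: $A,A^*$ is a tridiagonal pair and $\{E_i\}$, $\{E^*_i\}$ are standard orderings of the primitive idempotents of $A$, $A^*$. Assume that $\Phi$ has $q$-Racah type: there are nonzero $q,a,b\in\mathbb K$ with $q^4\neq1$ such that for $0\le i\le d$ the eigenvalue of $A$ for $E_i$ is $aq^{d-2i}+a^{-1}q^{2i-d}$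 and the eigenvalue of $A^*$ for $E^*_i$ is $bq^{d-2i}+b^{-1}q^{2i-d}$. Fix such $q,a,b$. For $0\le i\le d$ put $$U_i=(E_0^*V+\cdots+E_i^*V)\cap(E_iV+\cdots+E_dV),\qquad U_i^{\Downarrow}=(E_0^*V+\cdots+E_i^*V)\cap(E_0V+\cdots+E_{d-i}V),$$ and for $0\le i\le d/2$ put $K_i=(E_0^*V+\cdots+E_i^*V)\cap(E_iV+\cdots+E_{d-i}V)$. Then there are a unique invertible $K\in\mathrm{End}(V)$ acting on $U_i$ as $q^{d-2i}I$ for $0\le i\le d$, and a unique invertible $B\in\mathrm{End}(V)$ acting on $U_i^{\Downarrow}$ as $q^{d-2i}I$ for $0\le i\le d$. Put $$R=A-aK-a^{-1}K^{-1},\qquad R^{\Downarrow}=A-a^{-1}B-aB^{-1}.$$ There is a unique $\psi\in\mathrm{End}(V)$ such that $\psi R-R\psi=(q-q^{-1})(K-K^{-1})$ and $\psi K_i=0$ for $0\le i\le d/2$. Let $U_q(\mathfrak{sl}_2)$ be the unital associative $\mathbb K$-algebra with generators $e,f,k,k^{-1}$ and relations $kk^{-1}=k^{-1}k=1$, $kek^{-1}=q^2e$,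 $kfk^{-1}=q^{-2}f$, $ef-fe=(k-k^{-1})/(q-q^{-1})$. There is a unique $U_q(\mathfrak{sl}_2)$-module structure on $V$ in which $e,f,k,k^{-1}$ act as $(q-q^{-1})^{-1}\psi$, $(q-q^{-1})^{-1}R$, $K$, $K^{-1}$, and a unique one in which they act as $(q-q^{-1})^{-1}\psi$, $(q-q^{-1})^{-1}R^{\Downarrow}$, $B$, $B^{-1}$. The Casimir element $(q-q^{-1})^2ef+q^{-1}k+qk^{-1}$ acts on $V$ in the same way in both structures. Writing $\Lambda\in\mathrm{End}(V)$ for this common action, we have $$A^2\psi-(q^2+q^{-2})A\psi A+\psi A^2+(q^2-q^{-2})^2\psi=-(q-q^{-1})^2\Lambda A+(a+a^{-1})(q-q^{-1})^2(q+q^{-1})I$$ and $$\psi^2A-(q^2+q^{-2})\psi A\psi+A\psi^2=-(q-q^{-1})^2\Lambda\psi.$$ -/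

import Mathlib

namespace TDPair

section LinearAlgebra

variable {F V : Type*} [Field F] [AddCommGroup V] [Module F V]

/-- `A` is diagonalizable: `V` is spanned by the eigenspaces of `A`. -/
def IsDiagonalizable (A : Module.End F V) : Prop :=
  (⨆ μ : F, A.eigenspace μ) = ⊤

/-- `W 0, …, W d` is an ordering (without repetition) of the eigenspaces of `A`.
Eigenspaces are nonzero by convention. -/
def IsEigenspaceOrdering (A : Module.End F V) {d : ℕ}
    (W : Fin (d + 1) → Submodule F V) : Prop :=
  Function.Injective W ∧
    ∀ S : Submodule F V, (∃ i, W i = S) ↔ ∃ μ : F, A.HasEigenvalue μ ∧ S = A.eigenspace μ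

/-- The ordering `W 0, …, W d` of the eigenspaces of `A` is standard with respect to `C`:
`C (W i) ⊆ W (i - 1) + W i + W (i + 1)`, where `W (-1) = W (d + 1) = 0`. -/
def IsStandardOrdering (A C : Module.End F V) {d : ℕ}
    (W : Fin (d + 1) → Submodule F V) : Prop :=
  IsEigenspaceOrdering A W ∧
    ∀ i : Fin (d + 1), (W i).map C ≤
      ⨆ (j : Fin (d + 1)) (_ : (j : ℕ) ≤ i + 1 ∧ (i : ℕ) ≤ j + 1), W j

/-- The pair `A, Astar` is a tridiagonal pair on `V`. -/
structure IsTridiagonalPair (A Astar : Module.End F V) : Prop where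
  diag : IsDiagonalizable A
  diag_star : IsDiagonalizable Astar
  standard : ∃ (d : ℕ) (W : Fin (d + 1) → Submodule F V), IsStandardOrdering A Astar W
  standard_star :
    ∃ (δ : ℕ) (W : Fin (δ + 1) → Submodule F V), IsStandardOrdering Astar A W
  irreducible : ∀ W : Submodule F V, (∀ v ∈ W, A v ∈ W) → (∀ v ∈ W, Astar v ∈ W) →
    W = ⊥ ∨ W = ⊤

/-- `E 0, …, E d` is a standard ordering of the primitive idempotents of `A`: there is a
standard ordering `W 0, …, W d` of the eigenspaces of `A` such that `E i` is the identity
on `W i` and vanishes on every other `W j`. -/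
def IsStandardIdempotents (A C : Module.End F V) {d : ℕ}
    (E : Fin (d + 1) → Module.End F V) : Prop :=
  ∃ W : Fin (d + 1) → Submodule F V, IsStandardOrdering A C W ∧
    ∀ i, (∀ v ∈ W i, E i v = v) ∧ ∀ j, j ≠ i → ∀ v ∈ W j, E i v = 0

theorem IsStandardIdempotents.rev {A C : Module.End F V} {d : ℕ}
    {E : Fin (d + 1) → Module.End F V} (h : IsStandardIdempotents A C E) :
    IsStandardIdempotents A C (fun i => E i.rev) := by
  obtain ⟨W, ⟨⟨hinj, hW⟩, hC⟩, hE⟩ := h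
  refine ⟨fun i => W i.rev, ⟨⟨fun i j hij => Fin.rev_injective (hinj hij), fun S => ?_⟩,
    fun i => ?_⟩, fun i => ⟨(hE i.rev).1, fun j hj => (hE i.rev).2 j.rev
      (fun h => hj (Fin.rev_injective h))⟩⟩
  · rw [← hW S]
    constructor
    · rintro ⟨i, hi⟩
      exact ⟨i.rev, hi⟩
    · rintro ⟨i, hi⟩
      exact ⟨i.rev, by simpa using hi⟩
  · refine (hC i.rev).trans (iSup₂_le fun j hj => ?_)
    refine le_iSup₂_of_le j.rev ?_ (by simp)
    have hi := i.isLt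
    have hj' := j.isLt
    simp only [Fin.val_rev] at hj ⊢
    omega

end LinearAlgebra

/-- A tridiagonal system `(A; E 0, …, E d; Astar; Estar 0, …, Estar d)` on `V`. -/
structure TDSystem (F V : Type*) [Field F] [AddCommGroup V] [Module F V] (d : ℕ) where
  A : Module.End F V
  E : Fin (d + 1) → Module.End F V
  Astar : Module.End F V
  Estar : Fin (d + 1) → Module.End F V
  isTridiagonalPair : IsTridiagonalPair A Astar
  standard : IsStandardIdempotents A Astar E
  standard_star : IsStandardIdempotents Astar A Estar

namespace TDSystem

variable {F V : Type*} [Field F] [AddCommGroup V] [Module F V] {d : ℕ}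

/-- The second inversion of a tridiagonal system: reverse the order of the `E i`. -/
def secondInversion (Φ : TDSystem F V d) : TDSystem F V d where
  A := Φ.A
  E := fun i => Φ.E i.rev
  Astar := Φ.Astar
  Estar := Φ.Estar
  isTridiagonalPair := Φ.isTridiagonalPair
  standard := Φ.standard.rev
  standard_star := Φ.standard_star

/-- `Φ` has `q`-Racah type with parameters `q, a, b`: for `0 ≤ i ≤ d` the eigenvalue of `A`
associated with `E i` is `a q ^ (d - 2 i) + a⁻¹ q ^ (2 i - d)`, and the eigenvalue of `Astar`
associated with `Estar i` is `b q ^ (d - 2 i) + b⁻¹ q ^ (2 i - d)`. -/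
structure IsQRacah (Φ : TDSystem F V d) (q a b : F) : Prop where
  q_ne_zero : q ≠ 0
  a_ne_zero : a ≠ 0
  b_ne_zero : b ≠ 0
  q_pow_four_ne_one : q ^ 4 ≠ 1
  eigenvalue : ∀ i : Fin (d + 1), LinearMap.range (Φ.E i) =
    Φ.A.eigenspace (a * q ^ ((d : ℤ) - 2 * (i : ℕ)) + a⁻¹ * q ^ (2 * ((i : ℕ) : ℤ) - d))
  eigenvalue_star : ∀ i : Fin (d + 1), LinearMap.range (Φ.Estar i) =
    Φ.Astar.eigenspace (b * q ^ ((d : ℤ) - 2 * (i : ℕ)) + b⁻¹ * q ^ (2 * ((i : ℕ) : ℤ) - d))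

/-- The component `U i` of the first split decomposition of `V` with respect to `Φ`:
`(E*_0 V + ⋯ + E*_i V) ∩ (E_i V + ⋯ + E_d V)`. -/
def U (Φ : TDSystem F V d) (i : Fin (d + 1)) : Submodule F V :=
  (⨆ (j : Fin (d + 1)) (_ : j ≤ i), LinearMap.range (Φ.Estar j)) ⊓
    ⨆ (j : Fin (d + 1)) (_ : i ≤ j), LinearMap.range (Φ.E j)

/-- The subspace `K_i = (E*_0 V + ⋯ + E*_i V) ∩ (E_i V + ⋯ + E_{d-i} V)`, used only for
`0 ≤ i ≤ d / 2`. -/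
def highest (Φ : TDSystem F V d) (i : Fin (d + 1)) : Submodule F V :=
  (⨆ (j : Fin (d + 1)) (_ : j ≤ i), LinearMap.range (Φ.Estar j)) ⊓
    ⨆ (j : Fin (d + 1)) (_ : i ≤ j ∧ j ≤ i.rev), LinearMap.range (Φ.E j)

/-- The defining property of the map `K` of `Φ`: it acts on `U i` as `q ^ (d - 2 i)`, for
`0 ≤ i ≤ d`. The map `B` is the map `K` of the second inversion of `Φ`. -/
def IsSplitMap (Φ : TDSystem F V d) (q : F) (K : (Module.End F V)ˣ) : Prop :=
  ∀ i : Fin (d + 1), ∀ v ∈ Φ.U i,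
    (K : Module.End F V) v = q ^ ((d : ℤ) - 2 * (i : ℕ)) • v

/-- The raising map `A - a K - a⁻¹ K⁻¹`. For the second inversion of `Φ` the scalar `a` has to
be replaced by `a⁻¹` and `K` by `B`. -/
def raising (Φ : TDSystem F V d) (a : F) (K : (Module.End F V)ˣ) : Module.End F V :=
  Φ.A - a • (K : Module.End F V) - a⁻¹ • ((K⁻¹ : (Module.End F V)ˣ) : Module.End F V)

/-- The defining property of the double lowering operator `ψ` (where `K` is the split map):
`ψ R - R ψ = (q - q⁻¹) (K - K⁻¹)`, and `ψ K_i = 0` for `0 ≤ i ≤ d / 2`. -/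
def IsDoubleLowering (Φ : TDSystem F V d) (q a : F) (K : (Module.End F V)ˣ)
    (ψ : Module.End F V) : Prop :=
  ψ * Φ.raising a K - Φ.raising a K * ψ =
      (q - q⁻¹) • ((K : Module.End F V) - ((K⁻¹ : (Module.End F V)ˣ) : Module.End F V)) ∧
    ∀ i : Fin (d + 1), 2 * (i : ℕ) ≤ d → ∀ v ∈ Φ.highest i, ψ v = 0

end TDSystem

/-- The Chevalley generators `e, f, k, k⁻¹`. -/
inductive Chevalley : Type
  | e | f | k | kinv

/-- The defining relations of `U_q(sl₂)`. -/
inductive UqRel (F : Type*) [Field F] (q : F) :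
    FreeAlgebra F Chevalley → FreeAlgebra F Chevalley → Prop
  | k_kinv : UqRel F q
      (FreeAlgebra.ι F Chevalley.k * FreeAlgebra.ι F Chevalley.kinv) 1
  | kinv_k : UqRel F q
      (FreeAlgebra.ι F Chevalley.kinv * FreeAlgebra.ι F Chevalley.k) 1
  | k_e : UqRel F q
      (FreeAlgebra.ι F Chevalley.k * FreeAlgebra.ι F Chevalley.e *
        FreeAlgebra.ι F Chevalley.kinv)
      (q ^ 2 • FreeAlgebra.ι F Chevalley.e)
  | k_f : UqRel F q
      (FreeAlgebra.ι F Chevalley.k * FreeAlgebra.ι F Chevalley.f *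
        FreeAlgebra.ι F Chevalley.kinv)
      ((q ^ 2)⁻¹ • FreeAlgebra.ι F Chevalley.f)
  | e_f : UqRel F q
      (FreeAlgebra.ι F Chevalley.e * FreeAlgebra.ι F Chevalley.f -
        FreeAlgebra.ι F Chevalley.f * FreeAlgebra.ι F Chevalley.e)
      ((q - q⁻¹)⁻¹ • (FreeAlgebra.ι F Chevalley.k - FreeAlgebra.ι F Chevalley.kinv))

/-- The quantum algebra `U_q(sl₂)` over `F`, by generators and relations. -/
abbrev Uq (F : Type*) [Field F] (q : F) : Type _ := RingQuot (UqRel F q)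

/-- The image of a Chevalley generator in `U_q(sl₂)`. -/
noncomputable def gen {F : Type*} [Field F] (q : F) (x : Chevalley) : Uq F q :=
  RingQuot.mkAlgHom F (UqRel F q) (FreeAlgebra.ι F x)

/-- The normalized Casimir element `(q - q⁻¹)² e f + q⁻¹ k + q k⁻¹` of `U_q(sl₂)`. -/
noncomputable def casimir {F : Type*} [Field F] (q : F) : Uq F q :=
  (q - q⁻¹) ^ 2 • (gen q Chevalley.e * gen q Chevalley.f) +
    q⁻¹ • gen q Chevalley.k + q • gen q Chevalley.kinv

/-- The `U_q(sl₂)`-module structure `ρ` on `V` has the Chevalley generators `e, f, k, k⁻¹` act as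
`(q - q⁻¹)⁻¹ ψ`, `(q - q⁻¹)⁻¹ R`, `K`, `K⁻¹`. -/
structure IsChevalleyAction {F V : Type*} [Field F] [AddCommGroup V] [Module F V] (q : F)
    (ψ R : Module.End F V) (K : (Module.End F V)ˣ) (ρ : Uq F q →ₐ[F] Module.End F V) :
    Prop where
  e : ρ (gen q Chevalley.e) = (q - q⁻¹)⁻¹ • ψ
  f : ρ (gen q Chevalley.f) = (q - q⁻¹)⁻¹ • R
  k : ρ (gen q Chevalley.k) = (K : Module.End F V)
  kinv : ρ (gen q Chevalley.kinv) = ((K⁻¹ : (Module.End F V)ˣ) : Module.End F V)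

end TDPair

/-!
The eigenspaces of `Astar` and of `A` give two flags, the sums of the first `k` eigenspaces of
`Astar` and the sums of the eigenspaces of `A` with index at least `k`. Irreducibility makes them
complementary (`IsTD.isCompl_flags`): `A - θ k` raises and `Astar - φ (k - 1)` lowers the
intersections, so the sum of these is an invariant subspace, and it is proper. Hence `V` is the
direct sum of the components `U k`, on which `A - θ k` has degree one, and `K` exists.

The same complementarity for the reversed order of the eigenspaces of `A` shows that
`R ^ (d - 2 k)` is injective on `U k`, and the dimensions of `U k` and `U (d - k)` agree. So `R` has
the hard Lefschetz property (`IsTD.isLefschetz`), its primitive parts are the spaces `K_i`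
(`TDSystem.highest`), and the strings `R ^ j v` with `v ∈ K_i` decompose `V`. On each string the
conditions on `ψ` are a recursion, which gives its existence and uniqueness, the relation
`K ψ = q² ψ K`, and nilpotency.

The link with the second inversion is the identity `(1 - a⁻¹ q ψ) B = (1 - a q ψ) K`. Its solution
`B₀` satisfies `q B₀ A - q⁻¹ A B₀ = (q - q⁻¹) (a⁻¹ B₀² + a)`
(`WeightLink.weight_comm_apply`), and acts as `q ^ (d - 2 i)` on `K_i`, because `ψ` vanishes there.
The spaces `K_i` are the primitive parts for the second inversion too, so `B₀ = B` follows by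
induction along its raising map (`TDSystem.IsQRacah.weightLink`). Given this identity, the
`U_q(sl₂)`-relations for `ψ`, `B` and its raising map, the equality of the two Casimir actions,
and the two final relations are computations in an associative algebra.
-/

namespace TDPair

open Polynomial

/-! ### Sums of eigenspaces -/

section EigSup

variable {F V : Type*} [Field F] [AddCommGroup V] [Module F V]

/-- The sum of the eigenspaces of `A` for the scalars `θ j` with `j ∈ S`. -/
def eigSup (A : Module.End F V) (θ : ℕ → F) (S : Finset ℕ) : Submodule F V :=
  ⨆ j ∈ S, A.eigenspace (θ j)

variable {A : Module.End F V} {θ : ℕ → F}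

theorem eigenspace_le_eigSup {S : Finset ℕ} {j : ℕ} (hj : j ∈ S) :
    A.eigenspace (θ j) ≤ eigSup A θ S :=
  le_iSup₂_of_le j hj le_rfl

theorem eigSup_mono {S T : Finset ℕ} (h : S ⊆ T) : eigSup A θ S ≤ eigSup A θ T :=
  iSup₂_le fun _ hj => eigenspace_le_eigSup (h hj)

@[simp]
theorem eigSup_empty : eigSup A θ ∅ = ⊥ := by simp [eigSup]

theorem eigSup_insert (j : ℕ) (S : Finset ℕ) :
    eigSup A θ (insert j S) = A.eigenspace (θ j) ⊔ eigSup A θ S :=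
  Finset.iSup_insert _ _ _

theorem eigSup_union (S T : Finset ℕ) :
    eigSup A θ (S ∪ T) = eigSup A θ S ⊔ eigSup A θ T :=
  Finset.iSup_union

theorem eigSup_image (f : ℕ → ℕ) (S : Finset ℕ) :
    eigSup A θ (S.image f) = eigSup A (fun j => θ (f j)) S :=
  Finset.iSup_finset_image

theorem eigSup_le_comap {B : Module.End F V} {S : Finset ℕ} {N : Submodule F V}
    (h : ∀ j ∈ S, ∀ v ∈ A.eigenspace (θ j), B v ∈ N) {v : V} (hv : v ∈ eigSup A θ S) :
    B v ∈ N :=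
  (iSup₂_le fun j hj v hv => h j hj v hv : eigSup A θ S ≤ N.comap B) hv

theorem sub_smul_mem_eigSup_erase (m : ℕ) {S : Finset ℕ} {v : V} (hv : v ∈ eigSup A θ S) :
    A v - θ m • v ∈ eigSup A θ (S.erase m) := by
  refine eigSup_le_comap (B := A - θ m • 1) (fun j hj v hv => ?_) hv
  have hv' := Module.End.mem_eigenspace_iff.1 hv
  by_cases hjm : j = m
  · subst hjm
    simp [hv']
  · refine eigenspace_le_eigSup (Finset.mem_erase.2 ⟨hjm, hj⟩) ?_
    have : (A - θ m • (1 : Module.End F V)) v = (θ j - θ m) • v := by simp [hv', sub_smul]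
    rw [this]
    exact Submodule.smul_mem _ _ hv

theorem isCoprime_prod_X_sub_C {S T : Finset ℕ} (hST : Disjoint S T)
    (hθ : Set.InjOn θ (S ∪ T)) :
    IsCoprime (∏ j ∈ S, (X - C (θ j))) (∏ j ∈ T, (X - C (θ j))) := by
  refine IsCoprime.prod_left fun i hi => IsCoprime.prod_right fun j hj => ?_
  refine isCoprime_X_sub_C_of_isUnit_sub (sub_ne_zero_of_ne fun h => ?_).isUnit
  have hij := hθ (Or.inl hi) (Or.inr hj) h
  exact Finset.disjoint_left.1 hST hi (hij ▸ hj)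

theorem eigSup_eq_ker {S : Finset ℕ} (hθ : Set.InjOn θ S) :
    eigSup A θ S = LinearMap.ker (aeval A (∏ j ∈ S, (X - C (θ j)))) := by
  induction S using Finset.induction_on with
  | empty => simp [eigSup, LinearMap.ker_eq_bot_of_injective, Function.injective_id,
      Module.End.one_eq_id]
  | insert j S hj ih =>
    have hθ' : Set.InjOn θ S := hθ.mono (by simp)
    have hc : IsCoprime (X - C (θ j)) (∏ j ∈ S, (X - C (θ j))) := by
      have := isCoprime_prod_X_sub_C (θ := θ) (Finset.disjoint_singleton_left.2 hj)
        (by simpa [Set.singleton_union] using hθ)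
      simpa using this
    rw [eigSup_insert, ih hθ', Finset.prod_insert hj,
      ← sup_ker_aeval_eq_ker_aeval_mul_of_coprime A hc, Module.End.eigenspace_def]
    simp [Algebra.algebraMap_eq_smul_one]

theorem disjoint_eigSup {S T : Finset ℕ} (hST : Disjoint S T) (hθ : Set.InjOn θ (S ∪ T)) :
    Disjoint (eigSup A θ S) (eigSup A θ T) := by
  rw [eigSup_eq_ker (hθ.mono Set.subset_union_left),
    eigSup_eq_ker (hθ.mono Set.subset_union_right)]
  exact disjoint_ker_aeval_of_isCoprime A (isCoprime_prod_X_sub_C hST hθ)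

end EigSup

/-! ### The split decomposition -/

section Split

variable {F V : Type*} [Field F] [AddCommGroup V] [Module F V]

/-- `A, C` is a tridiagonal pair of diameter `d`, and `θ 0, …, θ d` and `φ 0, …, φ d` are the
eigenvalues of `A` and `C` in standard order. The values of `θ` and `φ` beyond `d` are
irrelevant. -/
structure IsTD (A C : Module.End F V) (d : ℕ) (θ φ : ℕ → F) : Prop where
  injOn : Set.InjOn θ (Finset.range (d + 1))
  injOn_star : Set.InjOn φ (Finset.range (d + 1))
  span : eigSup A θ (Finset.range (d + 1)) = ⊤
  span_star : eigSup C φ (Finset.range (d + 1)) = ⊤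
  tri : ∀ i ≤ d, ∀ v ∈ A.eigenspace (θ i),
    C v ∈ eigSup A θ ((Finset.range (d + 1)).filter fun j => j ≤ i + 1 ∧ i ≤ j + 1)
  tri_star : ∀ i ≤ d, ∀ v ∈ C.eigenspace (φ i),
    A v ∈ eigSup C φ ((Finset.range (d + 1)).filter fun j => j ≤ i + 1 ∧ i ≤ j + 1)
  ne_bot : ∀ i ≤ d, A.eigenspace (θ i) ≠ ⊥
  ne_bot_star : ∀ i ≤ d, C.eigenspace (φ i) ≠ ⊥
  irreducible : ∀ W : Submodule F V, (∀ v ∈ W, A v ∈ W) → (∀ v ∈ W, C v ∈ W) → W = ⊥ ∨ W = ⊤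

/-- The lower flag of `C`: the sum of its first `k` eigenspaces. -/
def lowerFlag (C : Module.End F V) (φ : ℕ → F) (k : ℕ) : Submodule F V :=
  eigSup C φ (Finset.range k)

/-- The upper flag of `A`: the sum of its eigenspaces with index at least `k`. -/
def upperFlag (A : Module.End F V) (d : ℕ) (θ : ℕ → F) (k : ℕ) : Submodule F V :=
  eigSup A θ (Finset.Icc k d)

/-- The components of the split decomposition, indexed by all natural numbers; they vanish
beyond `d`. -/
def splitU (A C : Module.End F V) (d : ℕ) (θ φ : ℕ → F) (k : ℕ) : Submodule F V :=
  lowerFlag C φ (k + 1) ⊓ upperFlag A d θ k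

variable {A C : Module.End F V} {d : ℕ} {θ φ : ℕ → F}

theorem lowerFlag_mono : Monotone (lowerFlag C φ) := fun _ _ h =>
  eigSup_mono (Finset.range_subset_range.2 h)

theorem upperFlag_anti : Antitone (upperFlag A d θ) := fun _ _ h =>
  eigSup_mono (Finset.Icc_subset_Icc_left h)

theorem upperFlag_eq_bot {k : ℕ} (hk : d < k) : upperFlag A d θ k = ⊥ := by
  simp [upperFlag, Finset.Icc_eq_empty_of_lt hk]

theorem splitU_eq_bot {k : ℕ} (hk : d < k) : splitU A C d θ φ k = ⊥ := by
  simp [splitU, upperFlag_eq_bot hk]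

theorem sub_smul_mem_upperFlag {k : ℕ} {v : V} (hv : v ∈ upperFlag A d θ k) :
    A v - θ k • v ∈ upperFlag A d θ (k + 1) := by
  refine eigSup_mono (fun j hj => ?_) (sub_smul_mem_eigSup_erase k hv)
  simp only [Finset.mem_erase, Finset.mem_Icc] at hj ⊢
  omega

theorem sub_smul_mem_lowerFlag {k : ℕ} {v : V} (hv : v ∈ lowerFlag C φ (k + 1)) :
    C v - φ k • v ∈ lowerFlag C φ k := by
  refine eigSup_mono (fun j hj => ?_) (sub_smul_mem_eigSup_erase k hv)
  simp only [Finset.mem_erase, Finset.mem_range] at hj ⊢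
  omega

namespace IsTD

theorem lowerFlag_eq_top (h : IsTD A C d θ φ) {k : ℕ} (hk : d < k) : lowerFlag C φ k = ⊤ :=
  top_unique (h.span_star ▸ eigSup_mono (Finset.range_subset_range.2 hk))

theorem upperFlag_zero (h : IsTD A C d θ φ) : upperFlag A d θ 0 = ⊤ :=
  top_unique (h.span ▸ eigSup_mono fun j hj => by
    simp only [Finset.mem_range, Finset.mem_Icc] at hj ⊢; omega)

theorem apply_mem_lowerFlag (h : IsTD A C d θ φ) {k : ℕ} {v : V} (hv : v ∈ lowerFlag C φ k) :
    A v ∈ lowerFlag C φ (k + 1) := by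
  by_cases hk : d < k + 1
  · rw [h.lowerFlag_eq_top hk]; trivial
  · refine eigSup_le_comap (fun j hj v hv => ?_) hv
    have hj' := Finset.mem_range.1 hj
    refine eigSup_mono (fun i hi => ?_) (h.tri_star j (by omega) v hv)
    simp only [Finset.mem_filter, Finset.mem_range] at hi ⊢
    omega

theorem apply_mem_upperFlag (h : IsTD A C d θ φ) {k : ℕ} {v : V}
    (hv : v ∈ upperFlag A d θ (k + 1)) : C v ∈ upperFlag A d θ k := by
  refine eigSup_le_comap (fun j hj v hv => ?_) hv
  have hj' := Finset.mem_Icc.1 hj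
  refine eigSup_mono (fun i hi => ?_) (h.tri j (by omega) v hv)
  simp only [Finset.mem_filter, Finset.mem_range, Finset.mem_Icc] at hi ⊢
  omega

/-- `A - θ k` raises and `C - φ (k - 1)` lowers the intersections of complementary flags, so
their sum is invariant under the pair; it misses the first eigenspace of `A`. -/
theorem disjoint_flags (h : IsTD A C d θ φ) (k : ℕ) :
    Disjoint (lowerFlag C φ k) (upperFlag A d θ k) := by
  set Z : ℕ → Submodule F V := fun k => lowerFlag C φ k ⊓ upperFlag A d θ k with hZ
  have hA : ∀ v ∈ ⨆ k, Z k, A v ∈ ⨆ k, Z k := by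
    refine fun v hv => (iSup_le fun k v hv => ?_ : ⨆ k, Z k ≤ (⨆ k, Z k).comap A) hv
    have h1 : A v - θ k • v ∈ Z (k + 1) :=
      ⟨sub_mem (h.apply_mem_lowerFlag hv.1)
        (Submodule.smul_mem _ _ (lowerFlag_mono k.le_succ hv.1)), sub_smul_mem_upperFlag hv.2⟩
    have h2 := add_mem (Submodule.mem_iSup_of_mem (k + 1) h1)
      (Submodule.smul_mem _ (θ k) (Submodule.mem_iSup_of_mem k hv))
    rwa [sub_add_cancel] at h2
  have hC : ∀ v ∈ ⨆ k, Z k, C v ∈ ⨆ k, Z k := by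
    refine fun v hv => (iSup_le fun k v hv => ?_ : ⨆ k, Z k ≤ (⨆ k, Z k).comap C) hv
    cases k with
    | zero =>
      have : v = 0 := by simpa [lowerFlag] using hv.1
      simp [this]
    | succ k =>
      have h1 : C v - φ k • v ∈ Z k :=
        ⟨sub_smul_mem_lowerFlag hv.1, sub_mem (h.apply_mem_upperFlag hv.2)
          (Submodule.smul_mem _ _ (upperFlag_anti k.le_succ hv.2))⟩
      have h2 := add_mem (Submodule.mem_iSup_of_mem k h1)
        (Submodule.smul_mem _ (φ k) (Submodule.mem_iSup_of_mem (k + 1) hv))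
      rwa [sub_add_cancel] at h2
  have hle : ⨆ k, Z k ≤ upperFlag A d θ 1 := iSup_le fun k => by
    cases k with
    | zero => simp [hZ, lowerFlag]
    | succ k => exact inf_le_right.trans (upperFlag_anti (by omega))
  rcases h.irreducible _ hA hC with h0 | h0
  · exact disjoint_iff.2 (le_bot_iff.1 (h0 ▸ le_iSup Z k))
  · rw [h0, top_le_iff] at hle
    have hd : Disjoint (eigSup A θ {0}) (upperFlag A d θ 1) :=
      disjoint_eigSup (by simp) (h.injOn.mono fun j hj => by
        simp only [Set.mem_union, Finset.mem_coe, Finset.mem_singleton, Finset.mem_Icc,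
          Finset.mem_range] at hj ⊢
        omega)
    rw [hle, disjoint_top] at hd
    exact absurd (by simpa [eigSup] using hd) (h.ne_bot 0 (Nat.zero_le d))

theorem raise_mem_splitU (h : IsTD A C d θ φ) {k : ℕ} {v : V} (hv : v ∈ splitU A C d θ φ k) :
    A v - θ k • v ∈ splitU A C d θ φ (k + 1) :=
  ⟨sub_mem (h.apply_mem_lowerFlag hv.1)
    (Submodule.smul_mem _ _ (lowerFlag_mono (k + 1).le_succ hv.1)), sub_smul_mem_upperFlag hv.2⟩

theorem iSup_splitU (h : IsTD A C d θ φ) : ⨆ k, splitU A C d θ φ k = ⊤ := by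
  set U := splitU A C d θ φ with hU
  have hA : ∀ v ∈ ⨆ k, U k, A v ∈ ⨆ k, U k := by
    refine fun v hv => (iSup_le fun k v hv => ?_ : ⨆ k, U k ≤ (⨆ k, U k).comap A) hv
    have h2 := add_mem (Submodule.mem_iSup_of_mem (k + 1) (h.raise_mem_splitU hv))
      (Submodule.smul_mem _ (θ k) (Submodule.mem_iSup_of_mem k hv))
    rwa [sub_add_cancel] at h2
  have hC : ∀ v ∈ ⨆ k, U k, C v ∈ ⨆ k, U k := by
    refine fun v hv => (iSup_le fun k v hv => ?_ : ⨆ k, U k ≤ (⨆ k, U k).comap C) hv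
    have h1 : C v - φ k • v ∈ ⨆ k, U k := by
      cases k with
      | zero =>
        have := sub_smul_mem_lowerFlag hv.1
        simp only [lowerFlag, Finset.range_zero, eigSup_empty, Submodule.mem_bot] at this
        rw [this]
        exact zero_mem _
      | succ k =>
        exact Submodule.mem_iSup_of_mem k
          ⟨sub_smul_mem_lowerFlag hv.1, sub_mem (h.apply_mem_upperFlag hv.2)
            (Submodule.smul_mem _ _ (upperFlag_anti k.le_succ hv.2))⟩
    have h2 := add_mem h1 (Submodule.smul_mem _ (φ k) (Submodule.mem_iSup_of_mem k hv))
    rwa [sub_add_cancel] at h2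
  refine (h.irreducible _ hA hC).resolve_left fun h0 => h.ne_bot_star 0 (Nat.zero_le d) ?_
  have h1 : U 0 = ⊥ := le_bot_iff.1 (h0 ▸ le_iSup U 0)
  simpa [hU, splitU, h.upperFlag_zero, lowerFlag, eigSup] using h1

theorem isCompl_flags (h : IsTD A C d θ φ) (k : ℕ) :
    IsCompl (lowerFlag C φ k) (upperFlag A d θ k) := by
  refine ⟨h.disjoint_flags k, codisjoint_iff.2 (top_unique ?_)⟩
  rw [← h.iSup_splitU]
  refine iSup_le fun j => ?_
  rcases lt_or_ge j k with hj | hj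
  · exact inf_le_left.trans ((lowerFlag_mono hj).trans le_sup_left)
  · exact inf_le_right.trans ((upperFlag_anti hj).trans le_sup_right)

theorem iSupIndep_splitU (h : IsTD A C d θ φ) : iSupIndep (splitU A C d θ φ) := by
  intro k
  have hle : ⨆ (j) (_ : j ≠ k), splitU A C d θ φ j ≤
      lowerFlag C φ k ⊔ upperFlag A d θ (k + 1) := iSup₂_le fun j hj => by
    rcases lt_or_gt_of_ne hj with hj | hj
    · exact inf_le_left.trans ((lowerFlag_mono hj).trans le_sup_left)
    · exact inf_le_right.trans ((upperFlag_anti hj).trans le_sup_right)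
  refine Disjoint.mono_right hle (Submodule.disjoint_def.2 fun x hx hx' => ?_)
  obtain ⟨l, hl, u, hu, rfl⟩ := Submodule.mem_sup.1 hx'
  have hu0 : u = 0 := by
    refine Submodule.disjoint_def.1 (h.disjoint_flags (k + 1)) u ?_ hu
    have := sub_mem hx.1 (lowerFlag_mono k.le_succ hl)
    rwa [add_sub_cancel_left] at this
  subst hu0
  rw [add_zero] at hx ⊢
  exact Submodule.disjoint_def.1 (h.disjoint_flags k) l hl hx.2

theorem upperFlag_eq_sup (h : IsTD A C d θ φ) (k : ℕ) :
    splitU A C d θ φ k ⊔ upperFlag A d θ (k + 1) = upperFlag A d θ k := by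
  rw [splitU, inf_comm, inf_sup_assoc_of_le _ (upperFlag_anti k.le_succ),
    (h.isCompl_flags (k + 1)).sup_eq_top, inf_top_eq]

/-- Reversing the order of the eigenspaces of `A` gives another tridiagonal system. -/
theorem flip (h : IsTD A C d θ φ) : IsTD A C d (fun j => θ (d - j)) φ where
  injOn i hi j hj hij := by
    simp only [Finset.coe_range, Set.mem_Iio] at hi hj
    have := h.injOn (by simp) (by simp) hij
    omega
  injOn_star := h.injOn_star
  span := by
    refine top_unique (h.span ▸ iSup₂_le fun j hj => ?_)
    have hj' := Finset.mem_range.1 hj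
    have := eigenspace_le_eigSup (A := A) (θ := fun j => θ (d - j)) (S := Finset.range (d + 1))
      (j := d - j) (by simp)
    simpa [show d - (d - j) = j by omega] using this
  span_star := h.span_star
  tri i hi v hv := by
    refine (iSup₂_le fun j hj => ?_ : _ ≤ eigSup A (fun j => θ (d - j)) _)
      (h.tri (d - i) (by omega) v hv)
    simp only [Finset.mem_filter, Finset.mem_range] at hj
    have := eigenspace_le_eigSup (A := A) (θ := fun j => θ (d - j))
      (S := (Finset.range (d + 1)).filter fun j => j ≤ i + 1 ∧ i ≤ j + 1)
      (j := d - j) (by simp only [Finset.mem_filter, Finset.mem_range]; omega)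
    simpa [show d - (d - j) = j by omega] using this
  tri_star := h.tri_star
  ne_bot i hi := h.ne_bot (d - i) (by omega)
  ne_bot_star := h.ne_bot_star
  irreducible := h.irreducible

theorem upperFlag_flip (k : ℕ) (hk : k ≤ d + 1) :
    upperFlag A d (fun j => θ (d - j)) k = eigSup A θ (Finset.range (d + 1 - k)) := by
  rw [upperFlag, ← eigSup_image]
  congr 1
  ext j
  simp only [Finset.mem_image, Finset.mem_Icc, Finset.mem_range]
  exact ⟨by rintro ⟨i, hi, rfl⟩; omega, fun hj => ⟨d - j, by omega, by omega⟩⟩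

theorem finrank_upperFlag_add [FiniteDimensional F V] (h : IsTD A C d θ φ) {k : ℕ}
    (hk : k ≤ d + 1) :
    Module.finrank F (upperFlag A d θ k) + Module.finrank F (upperFlag A d θ (d + 1 - k)) =
      Module.finrank F V := by
  have h1 := Submodule.finrank_add_eq_of_isCompl (h.isCompl_flags k)
  have h2 := Submodule.finrank_add_eq_of_isCompl (h.flip.isCompl_flags k)
  have h3 : IsCompl (upperFlag A d (fun j => θ (d - j)) k) (upperFlag A d θ (d + 1 - k)) := by
    rw [upperFlag_flip k hk]
    refine ⟨disjoint_eigSup ?_ (h.injOn.mono fun j hj => ?_), codisjoint_iff.2 ?_⟩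
    · refine Finset.disjoint_left.2 fun j hj hj' => ?_
      simp only [Finset.mem_range, Finset.mem_Icc] at hj hj'
      omega
    · simp only [Set.mem_union, Finset.mem_coe, Finset.mem_Icc, Finset.mem_range] at hj ⊢
      omega
    · rw [upperFlag, ← eigSup_union, eq_top_iff, ← h.span]
      refine eigSup_mono fun j hj => ?_
      simp only [Finset.mem_union, Finset.mem_range, Finset.mem_Icc] at hj ⊢
      omega
  have h4 := Submodule.finrank_add_eq_of_isCompl h3
  omega

theorem finrank_splitU_symm [FiniteDimensional F V] (h : IsTD A C d θ φ) {k : ℕ} (hk : k ≤ d) :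
    Module.finrank F (splitU A C d θ φ k) = Module.finrank F (splitU A C d θ φ (d - k)) := by
  have key : ∀ k, Module.finrank F (splitU A C d θ φ k) +
      Module.finrank F (upperFlag A d θ (k + 1)) = Module.finrank F (upperFlag A d θ k) := by
    intro k
    have hd : splitU A C d θ φ k ⊓ upperFlag A d θ (k + 1) = ⊥ :=
      disjoint_iff.1 ((h.disjoint_flags (k + 1)).mono_left inf_le_left)
    have := Submodule.finrank_sup_add_finrank_inf_eq (splitU A C d θ φ k)
      (upperFlag A d θ (k + 1))
    rw [h.upperFlag_eq_sup, hd, finrank_bot] at this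
    omega
  have h1 := key k
  have h2 := key (d - k)
  have h3 := h.finrank_upperFlag_add (k := k) (by omega)
  have h4 := h.finrank_upperFlag_add (k := k + 1) (by omega)
  rw [show d + 1 - (k + 1) = d - k by omega] at h4
  rw [show d + 1 - k = d - k + 1 by omega] at h3
  omega

end IsTD

end Split

/-! ### Graded spaces with the hard Lefschetz property -/

section Lefschetz

variable {F V : Type*} [Field F] [AddCommGroup V] [Module F V]

/-- `V` is graded by the subspaces `U 0, …, U d`, the map `R` has degree one, and `R ^ (d - 2 k)`
maps `U k` bijectively onto `U (d - k)` whenever `2 k ≤ d`. -/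
structure IsLefschetz (R : Module.End F V) (d : ℕ) (U : ℕ → Submodule F V) : Prop where
  indep : iSupIndep U
  span : ⨆ k, U k = ⊤
  eq_bot : ∀ k, d < k → U k = ⊥
  raise : ∀ k, ∀ v ∈ U k, R v ∈ U (k + 1)
  inj : ∀ k, 2 * k ≤ d → ∀ v ∈ U k, (R ^ (d - 2 * k)) v = 0 → v = 0
  surj : ∀ k, 2 * k ≤ d → ∀ u ∈ U (d - k), ∃ w ∈ U k, (R ^ (d - 2 * k)) w = u

/-- The primitive part of degree `i`: the elements of `U i` killed by `R ^ (d - 2 i + 1)`. It is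
meaningful for `2 i ≤ d` only. -/
def primitivePart (R : Module.End F V) (d : ℕ) (U : ℕ → Submodule F V) (i : ℕ) :
    Submodule F V :=
  U i ⊓ LinearMap.ker (R ^ (d - 2 * i + 1))

theorem _root_.iSupIndep.eq_zero_of_sum_eq_zero {ι : Type*} [DecidableEq ι]
    {U : ι → Submodule F V} (hU : iSupIndep U) {s : Finset ι} {x : ι → V}
    (hx : ∀ k ∈ s, x k ∈ U k) (h0 : ∑ k ∈ s, x k = 0) : ∀ k ∈ s, x k = 0 := by
  intro k hk
  refine Submodule.disjoint_def.1 (hU k) _ (hx k hk) ?_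
  rw [← Finset.add_sum_erase s x hk] at h0
  rw [eq_neg_of_add_eq_zero_left h0]
  refine neg_mem (sum_mem fun j hj => ?_)
  exact Submodule.mem_iSup_of_mem j
    (Submodule.mem_iSup_of_mem (Finset.mem_erase.1 hj).1 (hx j (Finset.mem_erase.1 hj).2))

/-- Linear maps are determined by their restrictions to the components of a decomposition. -/
theorem ext_of_iSup_eq_top {ι : Type*} {U : ι → Submodule F V} (hU : ⨆ k, U k = ⊤)
    {f g : Module.End F V} (h : ∀ k, ∀ v ∈ U k, f v = g v) : f = g := by
  have : LinearMap.eqLocus f g = ⊤ := top_unique (hU ▸ iSup_le fun k v hv => h k v hv)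
  exact LinearMap.ext fun v => (this ▸ Submodule.mem_top : v ∈ LinearMap.eqLocus f g)

theorem exists_end_smul {ι : Type*} [DecidableEq ι] {U : ι → Submodule F V} (hi : iSupIndep U)
    (hU : ⨆ k, U k = ⊤) (c : ι → F) : ∃ T : Module.End F V, ∀ k, ∀ v ∈ U k, T v = c k • v := by
  have hint := DirectSum.isInternal_submodule_of_iSupIndep_of_iSup_eq_top hi hU
  let e := LinearEquiv.ofBijective (DirectSum.coeLinearMap U) hint
  refine ⟨DirectSum.toModule F ι V (fun k => c k • (U k).subtype) ∘ₗ e.symm.toLinearMap,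
    fun k v hv => ?_⟩
  have he : e.symm v = DirectSum.lof F ι (fun k => U k) k ⟨v, hv⟩ := by
    rw [LinearEquiv.symm_apply_eq]
    exact (DirectSum.coeLinearMap_lof U k ⟨v, hv⟩).symm
  simp [he]

namespace IsLefschetz

variable {R : Module.End F V} {d : ℕ} {U : ℕ → Submodule F V}

theorem pow_mem (h : IsLefschetz R d U) (j : ℕ) {k : ℕ} {v : V} (hv : v ∈ U k) :
    (R ^ j) v ∈ U (k + j) := by
  induction j with
  | zero => simpa using hv
  | succ j ih => rw [pow_succ', Module.End.mul_apply]; exact h.raise _ _ ih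

/-- The components are spanned by the images of the primitive parts under the powers of `R`. -/
theorem le_of_pow_mem (h : IsLefschetz R d U) {S : ℕ → Submodule F V}
    (hS : ∀ i j, 2 * i + j ≤ d → ∀ v ∈ primitivePart R d U i, (R ^ j) v ∈ S (i + j)) (k : ℕ) :
    U k ≤ S k := by
  have low : ∀ k, ∀ S : ℕ → Submodule F V, 2 * k ≤ d →
      (∀ i j, 2 * i + j ≤ d → ∀ v ∈ primitivePart R d U i, (R ^ j) v ∈ S (i + j)) →
      U k ≤ S k := by
    intro k
    induction k with
    | zero =>
      intro S _ hS v hv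
      refine hS 0 0 (by omega) v ⟨hv, ?_⟩
      have := h.pow_mem (d - 2 * 0 + 1) hv
      rwa [h.eq_bot _ (by omega), Submodule.mem_bot] at this
    | succ k ih =>
      intro S hk hS v hv
      -- The part of `v` coming from `U k` is found by lifting `R ^ (d - 2 k - 1) v`.
      have h1 : (R ^ (d - 2 * (k + 1) + 1)) v ∈ U (d - k) := by
        have := h.pow_mem (d - 2 * (k + 1) + 1) hv
        rwa [show k + 1 + (d - 2 * (k + 1) + 1) = d - k by omega] at this
      obtain ⟨w, hw, hwv⟩ := h.surj k (by omega) _ h1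
      have hRw : R w ∈ S (k + 1) := by
        refine ih (fun m => (S (m + 1)).comap R) (by omega) (fun i j hij u hu => ?_) hw
        rw [Submodule.mem_comap, ← Module.End.mul_apply, ← pow_succ']
        rcases hij.lt_or_eq with hlt | heq
        · exact hS i (j + 1) (by omega) u hu
        · have : (R ^ (j + 1)) u = 0 := by
            have := hu.2
            rwa [show d - 2 * i + 1 = j + 1 by omega] at this
          rw [this]
          exact zero_mem _
      have hp : v - R w ∈ primitivePart R d U (k + 1) := by
        refine ⟨sub_mem hv (h.raise _ _ hw), ?_⟩
        rw [SetLike.mem_coe, LinearMap.mem_ker, map_sub, ← Module.End.mul_apply, ← pow_succ,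
          sub_eq_zero, ← hwv,
          show d - 2 * (k + 1) + 1 + 1 = d - 2 * k by omega]
      have := add_mem (hS (k + 1) 0 (by omega) _ hp) hRw
      simpa using this
  rcases le_or_gt (2 * k) d with hk | hk
  · exact low k S hk hS
  · rcases lt_or_ge d k with hk' | hk'
    · rw [h.eq_bot k hk']
      exact bot_le
    · intro u hu
      have hkk : d - (d - k) = k := by omega
      obtain ⟨w, hw, rfl⟩ := h.surj (d - k) (by omega) u (by rwa [hkk])
      have := low (d - k) (fun m => (S (m + (2 * k - d))).comap (R ^ (2 * k - d))) (by omega)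
        (fun i j hij v hv => ?_) hw
      · rw [Submodule.mem_comap, show d - k + (2 * k - d) = k by omega] at this
        rwa [show d - 2 * (d - k) = 2 * k - d by omega]
      · rw [Submodule.mem_comap, ← Module.End.mul_apply, ← pow_add, Nat.add_assoc,
          Nat.add_comm (2 * k - d) j]
        rcases le_or_gt (2 * i + (j + (2 * k - d))) d with hle | hlt
        · exact hS i _ hle v hv
        · have h0 : (R ^ (d - 2 * i + 1)) v = 0 := hv.2
          have : (R ^ (j + (2 * k - d))) v = 0 := by
            rw [show j + (2 * k - d) = (j + (2 * k - d) - (d - 2 * i + 1)) + (d - 2 * i + 1) by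
              omega, pow_add, Module.End.mul_apply, h0, map_zero]
          rw [this]
          exact zero_mem _

/-- Induction along `R` starting from the primitive parts. -/
theorem le_of_raise (h : IsLefschetz R d U) {S : ℕ → Submodule F V}
    (h0 : ∀ i, 2 * i ≤ d → primitivePart R d U i ≤ S i)
    (hS : ∀ k, ∀ v ∈ U k, v ∈ S k → R v ∈ S (k + 1)) (k : ℕ) : U k ≤ S k := by
  refine h.le_of_pow_mem (fun i j hij v hv => ?_) k
  induction j with
  | zero => exact h0 i hij hv
  | succ j ih =>
    rw [pow_succ', Module.End.mul_apply]
    exact hS _ _ (h.pow_mem j hv.1) (ih (by omega))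

/-- The space of families `(v i j)`, with `v i j` primitive of degree `i`, and zero unless
`2 i + j ≤ d`. -/
def primitiveFamily (R : Module.End F V) (d : ℕ) (U : ℕ → Submodule F V)
    (p : Fin (d + 1) × Fin (d + 1)) : Submodule F V :=
  if 2 * (p.1 : ℕ) + p.2 ≤ d then primitivePart R d U p.1 else ⊥

/-- The map sending a family `(v i j)` of primitive elements to the sum of all `R ^ j (v i j)`. -/
def lefschetzSum (R : Module.End F V) (d : ℕ) (U : ℕ → Submodule F V) :
    (∀ p, primitiveFamily R d U p) →ₗ[F] V :=
  ∑ p : Fin (d + 1) × Fin (d + 1),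
    (R ^ (p.2 : ℕ)) ∘ₗ (primitiveFamily R d U p).subtype ∘ₗ LinearMap.proj p

theorem lefschetzSum_apply (f : ∀ p, primitiveFamily R d U p) :
    lefschetzSum R d U f = ∑ p, (R ^ (p.2 : ℕ)) (f p : V) := by
  simp [lefschetzSum]

theorem primitiveFamily_le (p : Fin (d + 1) × Fin (d + 1)) :
    primitiveFamily R d U p ≤ primitivePart R d U p.1 := by
  unfold primitiveFamily
  split_ifs
  exacts [le_rfl, bot_le]

theorem primitiveFamily_eq_bot {p : Fin (d + 1) × Fin (d + 1)}
    (hp : ¬2 * (p.1 : ℕ) + p.2 ≤ d) : primitiveFamily R d U p = ⊥ :=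
  if_neg hp

theorem lefschetzSum_injective (h : IsLefschetz R d U) :
    Function.Injective (lefschetzSum R d U) := by
  rw [injective_iff_map_eq_zero]
  intro f hf
  rw [lefschetzSum_apply] at hf
  -- The homogeneous parts of the sum vanish separately.
  have hgr : ∀ k, ∑ p with (p.1 : ℕ) + p.2 = k, (R ^ (p.2 : ℕ)) (f p : V) = 0 := by
    intro k
    by_cases hk : k ∈ Finset.range (2 * d + 1)
    · refine h.indep.eq_zero_of_sum_eq_zero (s := Finset.range (2 * d + 1))
        (x := fun k => ∑ p with (p.1 : ℕ) + p.2 = k, (R ^ (p.2 : ℕ)) (f p : V))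
        (fun k _ => sum_mem fun p hp => ?_) ?_ k hk
      · rw [← (Finset.mem_filter.1 hp).2]
        exact h.pow_mem _ (primitiveFamily_le p (f p).2).1
      · rw [Finset.sum_fiberwise_of_maps_to (fun p _ => ?_), hf]
        have h1 := p.1.isLt
        have h2 := p.2.isLt
        rw [Finset.mem_range]
        omega
    · refine Finset.sum_eq_zero fun p hp => absurd ?_ hk
      have h1 := p.1.isLt
      have h2 := p.2.isLt
      have h3 := (Finset.mem_filter.1 hp).2
      rw [Finset.mem_range]
      omega
  have main : ∀ i : ℕ, ∀ p : Fin (d + 1) × Fin (d + 1), (p.1 : ℕ) = i → (f p : V) = 0 := by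
    intro i
    induction i using Nat.strong_induction_on with
    | _ i ih =>
      rintro p rfl
      by_cases hp : 2 * (p.1 : ℕ) + p.2 ≤ d
      · refine h.inj p.1 (by omega) _ (primitiveFamily_le p (f p).2).1 ?_
        -- Applying `R ^ (d - 2 i - j)` to the part of degree `i + j` isolates the term `(i, j)`.
        have h1 := congrArg (R ^ (d - 2 * (p.1 : ℕ) - p.2)) (hgr (p.1 + p.2))
        rw [map_zero, map_sum, Finset.sum_eq_single p] at h1
        · rwa [← Module.End.mul_apply, ← pow_add, Nat.sub_add_cancel (by omega)] at h1
        · intro p' hp' hne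
          have hsum := (Finset.mem_filter.1 hp').2
          rcases lt_trichotomy (p'.1 : ℕ) p.1 with hlt | heq | hgt
          · rw [ih _ hlt p' rfl, map_zero, map_zero]
          · exact absurd (Prod.ext (Fin.ext heq) (Fin.ext (by omega))) hne
          · rw [← Module.End.mul_apply, ← pow_add]
            by_cases hp'' : 2 * (p'.1 : ℕ) + p'.2 ≤ d
            swap
            · rw [(Submodule.mem_bot F).1 ((primitiveFamily_eq_bot hp'').le (f p').2), map_zero]
            have h0 : (R ^ (d - 2 * (p'.1 : ℕ) + 1)) (f p' : V) = 0 :=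
              (primitiveFamily_le p' (f p').2).2
            rw [show d - 2 * (p.1 : ℕ) - p.2 + p'.2 =
              (d - 2 * (p.1 : ℕ) - p.2 + p'.2 - (d - 2 * (p'.1 : ℕ) + 1)) +
                (d - 2 * (p'.1 : ℕ) + 1) by omega, pow_add, Module.End.mul_apply, h0, map_zero]
        · simp
      · exact (Submodule.mem_bot F).1 ((primitiveFamily_eq_bot hp).le (f p).2)
  exact funext fun p => Subtype.ext (main _ p rfl)

/-- The family with the single entry `v` at `(i, j)`. The map `c` is left arbitrary so that both the
sum of strings and the lowering operator defined below can be evaluated on it. -/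
theorem lefschetzSum_single {i j : ℕ} (hij : 2 * i + j ≤ d) {v : V}
    (hv : v ∈ primitivePart R d U i) :
    ∃ f : ∀ p, primitiveFamily R d U p, ∀ c : ℕ → ℕ → V →ₗ[F] V,
      ∑ p, c p.1 p.2 (f p : V) = c i j v := by
  classical
  set p₀ : Fin (d + 1) × Fin (d + 1) := (⟨i, by omega⟩, ⟨j, by omega⟩) with hp₀
  have hv' : v ∈ primitiveFamily R d U p₀ := by
    unfold primitiveFamily
    rwa [if_pos (by simpa [hp₀] using hij)]
  refine ⟨Pi.single p₀ ⟨v, hv'⟩, fun c => ?_⟩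
  rw [Finset.sum_eq_single p₀]
  · rw [Pi.single_eq_same]
  · intro p _ hp
    rw [Pi.single_eq_of_ne hp]
    simp
  · simp

theorem lefschetzSum_surjective (h : IsLefschetz R d U) :
    Function.Surjective (lefschetzSum R d U) := by
  rw [← LinearMap.range_eq_top, eq_top_iff, ← h.span]
  refine iSup_le fun k => h.le_of_pow_mem (S := fun _ => LinearMap.range (lefschetzSum R d U))
    (fun i j hij v hv => ?_) k
  obtain ⟨f, hf⟩ := lefschetzSum_single hij hv
  exact ⟨f, by rw [lefschetzSum_apply, ← hf fun _ j => R ^ j]⟩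

/-- A lowering operator with prescribed scalar commutator with `R`: it vanishes on the primitive
parts, and exists because the strings `R ^ j v` with `v` primitive form a decomposition. The
condition on `c` makes the recursion compatible with `R ^ (d - 2 i + 1) v = 0`. -/
theorem exists_lowering (h : IsLefschetz R d U) (c : ℕ → F)
    (hc : ∀ i, 2 * i ≤ d → ∑ m ∈ Finset.range (d - 2 * i + 1), c (i + m) = 0) :
    ∃ ψ : Module.End F V, (∀ k, ∀ v ∈ U k, ψ (R v) - R (ψ v) = c k • v) ∧
      ∀ i, 2 * i ≤ d → ∀ v ∈ primitivePart R d U i, ψ v = 0 := by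
  let e := LinearEquiv.ofBijective (lefschetzSum R d U)
    ⟨h.lefschetzSum_injective, h.lefschetzSum_surjective⟩
  let g : ℕ → ℕ → V →ₗ[F] V := fun i j => (∑ m ∈ Finset.range j, c (i + m)) • R ^ (j - 1)
  let ψ : Module.End F V := (∑ p : Fin (d + 1) × Fin (d + 1),
    g p.1 p.2 ∘ₗ (primitiveFamily R d U p).subtype ∘ₗ LinearMap.proj p) ∘ₗ e.symm.toLinearMap
  have hψ : ∀ i j, 2 * i + j ≤ d → ∀ v ∈ primitivePart R d U i, ψ ((R ^ j) v) = g i j v := by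
    intro i j hij v hv
    obtain ⟨f, hf⟩ := lefschetzSum_single hij hv
    have he : e.symm ((R ^ j) v) = f := by
      rw [LinearEquiv.symm_apply_eq]
      change _ = lefschetzSum R d U f
      rw [lefschetzSum_apply, hf fun _ j => R ^ j]
    rw [← hf g]
    simp [ψ, he]
  have hψ' : ∀ i j, 2 * i ≤ d → j ≤ d - 2 * i + 1 → ∀ v ∈ primitivePart R d U i,
      ψ ((R ^ j) v) = g i j v := by
    intro i j hi hj v hv
    rcases hj.lt_or_eq with hlt | rfl
    · exact hψ i j (by omega) v hv
    · have h0 : (R ^ (d - 2 * i + 1)) v = 0 := hv.2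
      simp [g, h0, hc i hi]
  refine ⟨ψ, fun k v hv => ?_, fun i hi v hv => ?_⟩
  · have hle := h.le_of_pow_mem
      (S := fun k => LinearMap.ker (ψ * R - R * ψ - c k • (1 : Module.End F V)))
      (fun i j hij v hv => ?_) k
    · have := hle hv
      rw [LinearMap.mem_ker] at this
      exact sub_eq_zero.1 (by simpa using this)
    · have h1 := hψ' i j (by omega) (by omega) v hv
      have h2 := hψ' i (j + 1) (by omega) (by omega) v hv
      rw [pow_succ', Module.End.mul_apply] at h2
      have h3 : R (ψ ((R ^ j) v)) = (∑ m ∈ Finset.range j, c (i + m)) • (R ^ j) v := by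
        rw [h1]
        cases j with
        | zero => simp [g]
        | succ j => simp [g, pow_succ']
      simp only [LinearMap.mem_ker, LinearMap.sub_apply, Module.End.mul_apply,
        LinearMap.smul_apply, Module.End.one_apply, h2, h3]
      simp [g, Finset.sum_range_succ, add_smul]
  · have := hψ i 0 hi v hv
    simpa [g] using this

end IsLefschetz

end Lefschetz

/-! ### The split decomposition has the hard Lefschetz property -/

section SplitLefschetz

variable {F V : Type*} [Field F] [AddCommGroup V] [Module F V]
  {A C R : Module.End F V} {d : ℕ} {θ φ : ℕ → F}

namespace IsTD

theorem pow_raising_apply (h : IsTD A C d θ φ)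
    (hR : ∀ k, ∀ v ∈ splitU A C d θ φ k, R v = A v - θ k • v) {k : ℕ} {v : V}
    (hv : v ∈ splitU A C d θ φ k) (j : ℕ) :
    (R ^ j) v = aeval A (∏ m ∈ Finset.Ico k (k + j), (X - Polynomial.C (θ m))) v ∧
      (R ^ j) v ∈ splitU A C d θ φ (k + j) := by
  induction j with
  | zero => simpa using hv
  | succ j ih =>
    have h1 : (R ^ (j + 1)) v = A ((R ^ j) v) - θ (k + j) • (R ^ j) v := by
      rw [pow_succ', Module.End.mul_apply, hR _ _ ih.2]
    refine ⟨?_, h1 ▸ h.raise_mem_splitU ih.2⟩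
    rw [h1, ih.1, ← Nat.add_assoc, Finset.prod_Ico_succ_top (by omega), mul_comm]
    simp [Algebra.algebraMap_eq_smul_one]

theorem pow_raising_eq_zero_iff (h : IsTD A C d θ φ)
    (hR : ∀ k, ∀ v ∈ splitU A C d θ φ k, R v = A v - θ k • v) {k j : ℕ} (hkj : k + j ≤ d + 1)
    {v : V} (hv : v ∈ splitU A C d θ φ k) :
    (R ^ j) v = 0 ↔ v ∈ eigSup A θ (Finset.Ico k (k + j)) := by
  rw [(h.pow_raising_apply hR hv j).1, eigSup_eq_ker (h.injOn.mono fun m hm => ?_),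
    LinearMap.mem_ker]
  simp only [Finset.coe_Ico, Set.mem_Ico, Finset.coe_range, Set.mem_Iio] at hm ⊢
  omega

/-- If `R ^ (d - 2 k)` kills `v ∈ U k`, then `v` lies in the intersection of complementary flags
of the system with the eigenspaces of `A` reversed. -/
theorem isLefschetz [FiniteDimensional F V] (h : IsTD A C d θ φ)
    (hR : ∀ k, ∀ v ∈ splitU A C d θ φ k, R v = A v - θ k • v) :
    IsLefschetz R d (splitU A C d θ φ) := by
  have inj : ∀ k, 2 * k ≤ d → ∀ v ∈ splitU A C d θ φ k, (R ^ (d - 2 * k)) v = 0 → v = 0 := by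
    intro k hk v hv h0
    rw [h.pow_raising_eq_zero_iff hR (by omega) hv] at h0
    refine Submodule.disjoint_def.1 (h.flip.disjoint_flags (k + 1)) v hv.1 ?_
    rw [upperFlag_flip _ (by omega)]
    refine eigSup_mono (fun m hm => ?_) h0
    simp only [Finset.mem_Ico, Finset.mem_range] at hm ⊢
    omega
  refine ⟨h.iSupIndep_splitU, h.iSup_splitU, fun k hk => splitU_eq_bot hk,
    fun k v hv => hR k v hv ▸ h.raise_mem_splitU hv, inj, fun k hk u hu => ?_⟩
  have hmaps : ∀ v ∈ splitU A C d θ φ k, (R ^ (d - 2 * k)) v ∈ splitU A C d θ φ (d - k) := by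
    intro v hv
    have := (h.pow_raising_apply hR hv (d - 2 * k)).2
    rwa [show k + (d - 2 * k) = d - k by omega] at this
  let f := (R ^ (d - 2 * k)).restrict hmaps
  have hf : Function.Injective f := (injective_iff_map_eq_zero f).2 fun v hv =>
    Subtype.ext (inj k hk v v.2 (congrArg Subtype.val hv))
  obtain ⟨w, hw⟩ := (LinearMap.injective_iff_surjective_of_finrank_eq_finrank
    (h.finrank_splitU_symm (by omega))).1 hf ⟨u, hu⟩
  exact ⟨w, w.2, congrArg Subtype.val hw⟩

/-- This description of the primitive parts is symmetric under reversing the eigenspaces of `A`. -/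
theorem primitivePart_eq (h : IsTD A C d θ φ)
    (hR : ∀ k, ∀ v ∈ splitU A C d θ φ k, R v = A v - θ k • v) {i : ℕ} (hi : 2 * i ≤ d) :
    primitivePart R d (splitU A C d θ φ) i =
      lowerFlag C φ (i + 1) ⊓ eigSup A θ (Finset.Icc i (d - i)) := by
  have hI : Finset.Ico i (i + (d - 2 * i + 1)) = Finset.Icc i (d - i) := by
    ext m
    simp only [Finset.mem_Ico, Finset.mem_Icc]
    omega
  ext v
  constructor
  · rintro ⟨hv, h0⟩
    exact ⟨hv.1, hI ▸ (h.pow_raising_eq_zero_iff hR (by omega) hv).1 h0⟩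
  · rintro ⟨h1, h2⟩
    have hv : v ∈ splitU A C d θ φ i :=
      ⟨h1, eigSup_mono (Finset.Icc_subset_Icc_right (by omega)) h2⟩
    exact ⟨hv, (h.pow_raising_eq_zero_iff hR (by omega) hv).2 (hI ▸ h2)⟩

end IsTD

end SplitLefschetz

/-! ### Relations of `U_q(sl₂)` in an associative algebra -/

section Relations

variable {F E : Type*} [Field F] [Ring E] [Algebra F E]

/-- The elements `ψ, R, K, K'` satisfy the defining relations of `U_q(sl₂)`, in the normalization
where `e, f, k, k⁻¹` correspond to `(q - q⁻¹)⁻¹ ψ, (q - q⁻¹)⁻¹ R, K, K'`. -/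
structure UqTriple (q : F) (ψ R K K' : E) : Prop where
  mul_inv : K * K' = 1
  inv_mul : K' * K = 1
  lower : K * ψ = q ^ 2 • (ψ * K)
  raise : K * R = (q ^ 2)⁻¹ • (R * K)
  comm : ψ * R - R * ψ = (q - q⁻¹) • (K - K')

/-- If `K x = c x K` with `c` a nonzero scalar then `K⁻¹ x = c⁻¹ x K⁻¹`. -/
theorem inv_mul_eq_smul {K K' x : E} {c : F} (hc : c ≠ 0) (h1 : K * K' = 1) (h2 : K' * K = 1)
    (h : K * x = c • (x * K)) : K' * x = c⁻¹ • (x * K') := by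
  have h3 : K' * (K * x) * K' = c • (K' * x) := by
    rw [h, mul_smul_comm, smul_mul_assoc, mul_assoc, mul_assoc, h1, mul_one]
  rw [← mul_assoc K', h2, one_mul] at h3
  rw [h3, smul_smul, inv_mul_cancel₀ hc, one_smul]

namespace UqTriple

variable {q a : F} {ψ R K K' : E}

theorem inv_lower (hq : q ≠ 0) (h : UqTriple q ψ R K K') : K' * ψ = (q ^ 2)⁻¹ • (ψ * K') :=
  inv_mul_eq_smul (pow_ne_zero 2 hq) h.mul_inv h.inv_mul h.lower

theorem inv_raise (hq : q ≠ 0) (h : UqTriple q ψ R K K') : K' * R = q ^ 2 • (R * K') := by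
  simpa using inv_mul_eq_smul (inv_ne_zero (pow_ne_zero 2 hq)) h.mul_inv h.inv_mul h.raise

theorem raise_lower (h : UqTriple q ψ R K K') : R * ψ = ψ * R - (q - q⁻¹) • (K - K') := by
  rw [← h.comm, sub_sub_cancel]

/-- The first relation between `A = R + a K + a⁻¹ K⁻¹`, `ψ` and the Casimir element. -/
theorem casimir_relation (hq : q ≠ 0) (ha : a ≠ 0) (h : UqTriple q ψ R K K') {A : E}
    (hA : A = R + a • K + a⁻¹ • K') :
    A ^ 2 * ψ - (q ^ 2 + (q ^ 2)⁻¹) • (A * ψ * A) + ψ * A ^ 2 + (q ^ 2 - (q ^ 2)⁻¹) ^ 2 • ψ =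
      -((q - q⁻¹) ^ 2 • ((ψ * R + q⁻¹ • K + q • K') * A)) +
        ((a + a⁻¹) * (q - q⁻¹) ^ 2 * (q + q⁻¹)) • (1 : E) := by
  have h1 : ∀ x, K * (ψ * x) = q ^ 2 • (ψ * (K * x)) := fun x => by
    rw [← mul_assoc, h.lower, smul_mul_assoc, mul_assoc]
  have h2 : ∀ x, K' * (ψ * x) = (q ^ 2)⁻¹ • (ψ * (K' * x)) := fun x => by
    rw [← mul_assoc, h.inv_lower hq, smul_mul_assoc, mul_assoc]
  have h5 : ∀ x, R * (ψ * x) = ψ * (R * x) - (q - q⁻¹) • (K * x - K' * x) := fun x => by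
    rw [← mul_assoc, h.raise_lower, sub_mul, smul_mul_assoc, mul_assoc, sub_mul]
  subst hA
  simp only [pow_two, mul_add, add_mul, mul_sub, sub_mul, smul_mul_assoc, mul_smul_comm,
    mul_assoc, h.mul_inv, h.inv_mul, h.lower, h.inv_lower hq, h.raise, h.inv_raise hq,
    h.raise_lower, h1, h2, h5, mul_one, one_mul]
  match_scalars <;> field_simp <;> ring

/-- The second relation between `A = R + a K + a⁻¹ K⁻¹`, `ψ` and the Casimir element. -/
theorem casimir_relation_lower (hq : q ≠ 0) (ha : a ≠ 0) (h : UqTriple q ψ R K K') {A : E}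
    (hA : A = R + a • K + a⁻¹ • K') :
    ψ ^ 2 * A - (q ^ 2 + (q ^ 2)⁻¹) • (ψ * A * ψ) + A * ψ ^ 2 =
      -((q - q⁻¹) ^ 2 • ((ψ * R + q⁻¹ • K + q • K') * ψ)) := by
  have h1 : ∀ x, K * (ψ * x) = q ^ 2 • (ψ * (K * x)) := fun x => by
    rw [← mul_assoc, h.lower, smul_mul_assoc, mul_assoc]
  have h2 : ∀ x, K' * (ψ * x) = (q ^ 2)⁻¹ • (ψ * (K' * x)) := fun x => by
    rw [← mul_assoc, h.inv_lower hq, smul_mul_assoc, mul_assoc]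
  have h5 : ∀ x, R * (ψ * x) = ψ * (R * x) - (q - q⁻¹) • (K * x - K' * x) := fun x => by
    rw [← mul_assoc, h.raise_lower, sub_mul, smul_mul_assoc, mul_assoc, sub_mul]
  subst hA
  simp only [pow_two, mul_add, add_mul, mul_sub, sub_mul, smul_mul_assoc, mul_smul_comm,
    mul_assoc, h.lower, h.inv_lower hq, h.raise_lower, h1, h2, h5]
  match_scalars <;> field_simp <;> ring

theorem lower_comm_apply (hq : q ≠ 0) (ha : a ≠ 0) (h : UqTriple q ψ R K K') {A : E}
    (hA : A = R + a • K + a⁻¹ • K') :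
    ψ * A - A * ψ = (q - q⁻¹) •
      ((1 - (a * q) • ψ) * K - (1 - (a⁻¹ * q⁻¹) • ψ) * K') := by
  subst hA
  simp only [mul_add, add_mul, sub_mul, smul_mul_assoc, mul_smul_comm, h.lower, h.inv_lower hq,
    h.raise_lower, one_mul]
  match_scalars <;> field_simp <;> ring

theorem weight_comm_apply (hq : q ≠ 0) (ha : a ≠ 0) (h : UqTriple q ψ R K K') {A : E}
    (hA : A = R + a • K + a⁻¹ • K') :
    q • (K * A) - q⁻¹ • (A * K) = (q - q⁻¹) • (a • (K * K) + a⁻¹ • 1) := by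
  subst hA
  simp only [mul_add, add_mul, smul_mul_assoc, mul_smul_comm, h.raise, h.mul_inv, h.inv_mul]
  match_scalars <;> field_simp <;> ring

end UqTriple

/-- The conditions linking the weight operator `K` of the split decomposition to the weight
operator `B` of its inversion: `(1 - a⁻¹ q ψ) B = (1 - a q ψ) K`, where both are invertible and
`1 - a⁻¹ q ψ` can be cancelled on the left. -/
structure WeightLink (q a : F) (ψ K B B' : E) : Prop where
  mul_inv : B * B' = 1
  inv_mul : B' * B = 1
  cancel : ∀ x y : E, (1 - (a⁻¹ * q) • ψ) * x = (1 - (a⁻¹ * q) • ψ) * y → x = y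
  link : (1 - (a⁻¹ * q) • ψ) * B = (1 - (a * q) • ψ) * K

namespace WeightLink

variable {q a : F} {ψ R K K' A B B' : E}

theorem lower (h : UqTriple q ψ R K K') (hB : WeightLink q a ψ K B B') :
    B * ψ = q ^ 2 • (ψ * B) := by
  apply hB.cancel
  have h1 := congrArg (· * ψ) hB.link
  have h2 := congrArg (ψ * ·) hB.link
  simp only [sub_mul, mul_sub, one_mul, smul_mul_assoc, mul_smul_comm, mul_assoc,
    h.lower] at h1 h2 ⊢
  rw [h1, smul_comm (a * q), ← smul_sub, h2]

theorem inv_link (hq : q ≠ 0) (ha : a ≠ 0) (h : UqTriple q ψ R K K')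
    (hB : WeightLink q a ψ K B B') :
    (1 - (a * q⁻¹) • ψ) * B' = (1 - (a⁻¹ * q⁻¹) • ψ) * K' := by
  have hl := hB.lower h
  have h1 : B * (1 - (a⁻¹ * q⁻¹) • ψ) = (1 - (a⁻¹ * q) • ψ) * B := by
    simp only [mul_sub, sub_mul, one_mul, mul_one, mul_smul_comm, smul_mul_assoc, hl]
    match_scalars <;> field_simp
  have h2 : K * (1 - (a * q⁻¹) • ψ) = (1 - (a * q) • ψ) * K := by
    simp only [mul_sub, sub_mul, one_mul, mul_one, mul_smul_comm, smul_mul_assoc, h.lower]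
    match_scalars <;> field_simp
  have h3 : K' * (1 - (a⁻¹ * q) • ψ) = (1 - (a⁻¹ * q⁻¹) • ψ) * K' := by
    simp only [mul_sub, sub_mul, one_mul, mul_one, mul_smul_comm, smul_mul_assoc,
      h.inv_lower hq]
    match_scalars <;> field_simp
  calc (1 - (a * q⁻¹) • ψ) * B' = K' * (K * (1 - (a * q⁻¹) • ψ)) * B' := by
        rw [← mul_assoc K', h.inv_mul, one_mul]
    _ = K' * (1 - (a⁻¹ * q) • ψ) * (B * B') := by
        rw [h2, ← hB.link]; simp only [mul_assoc]
    _ = _ := by rw [hB.mul_inv, mul_one, h3]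

theorem weight_comm_apply (hq : q ≠ 0) (ha : a ≠ 0) (h : UqTriple q ψ R K K')
    (hA : A = R + a • K + a⁻¹ • K') (hB : WeightLink q a ψ K B B') :
    q • (B * A) - q⁻¹ • (A * B) = (q - q⁻¹) • (a⁻¹ • (B * B) + a • 1) := by
  apply hB.cancel
  -- Both commutator formulas for `ψ` and `A` are used, one for `K` and one for `B`.
  have h1 := hB.link
  have h2 := h.weight_comm_apply hq ha hA
  have h3 : (ψ * A - A * ψ) * K = (q - q⁻¹) •
      ((1 - (a * q) • ψ) * (K * K) - (1 - (a⁻¹ * q⁻¹) • ψ)) := by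
    rw [h.lower_comm_apply hq ha hA, smul_mul_assoc, sub_mul, mul_assoc, mul_assoc, h.inv_mul,
      mul_one]
  have h4 : (ψ * A - A * ψ) * B = (q - q⁻¹) •
      ((1 - (a⁻¹ * q) • ψ) * (B * B) - (1 - (a * q⁻¹) • ψ)) := by
    rw [h.lower_comm_apply hq ha hA, ← hB.link, ← hB.inv_link hq ha h, smul_mul_assoc, sub_mul,
      mul_assoc, mul_assoc, hB.inv_mul, mul_one]
  linear_combination (norm := skip) q • (h1 * A) - q⁻¹ • (A * h1) +
    (1 - (a * q) • ψ) * h2 - a • h3 + a⁻¹ • h4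
  simp only [mul_add, mul_sub, sub_mul, smul_mul_assoc, mul_smul_comm, mul_assoc,
    one_mul, mul_one]
  match_scalars <;> field_simp <;> ring

/-- The operator `B` gives rise to a second set of elements satisfying the defining relations,
with the same `ψ`. -/
theorem uqTriple (hq : q ≠ 0) (ha : a ≠ 0) (h : UqTriple q ψ R K K')
    (hA : A = R + a • K + a⁻¹ • K') (hB : WeightLink q a ψ K B B') :
    UqTriple q ψ (A - a⁻¹ • B - a • B') B B' where
  mul_inv := hB.mul_inv
  inv_mul := hB.inv_mul
  lower := hB.lower h
  raise := by
    have h1 := hB.weight_comm_apply hq ha h hA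
    linear_combination (norm := skip) q⁻¹ • h1
    simp only [mul_sub, sub_mul, smul_mul_assoc, mul_smul_comm, hB.mul_inv, hB.inv_mul]
    match_scalars <;> field_simp <;> ring
  comm := by
    have h1 := h.lower_comm_apply hq ha hA
    rw [← hB.link, ← hB.inv_link hq ha h] at h1
    have h2 := hB.lower h
    have h3 := inv_mul_eq_smul (pow_ne_zero 2 hq) hB.mul_inv hB.inv_mul h2
    linear_combination (norm := skip) h1
    simp only [mul_sub, sub_mul, smul_mul_assoc, mul_smul_comm, h2, h3, one_mul]
    match_scalars <;> field_simp <;> ring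

theorem casimir_eq (hq : q ≠ 0) (ha : a ≠ 0) (h : UqTriple q ψ R K K')
    (hA : A = R + a • K + a⁻¹ • K') (hB : WeightLink q a ψ K B B') :
    ψ * R + q⁻¹ • K + q • K' = ψ * (A - a⁻¹ • B - a • B') + q⁻¹ • B + q • B' := by
  have h1 := hB.link
  have h2 := hB.inv_link hq ha h
  subst hA
  linear_combination (norm := skip) -q⁻¹ • h1 - q • h2
  simp only [mul_add, mul_sub, sub_mul, smul_mul_assoc, mul_smul_comm, one_mul]
  match_scalars <;> field_simp <;> ring

end WeightLink

end Relations

/-! ### Modules for `U_q(sl₂)` -/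

section Modules

variable {F V : Type*} [Field F] [AddCommGroup V] [Module F V] {q : F}
  {ψ R : Module.End F V} {K : (Module.End F V)ˣ}

theorem UqTriple.existsUnique_chevalleyAction (hqq : q - q⁻¹ ≠ 0)
    (h : UqTriple q ψ R (K : Module.End F V) ((K⁻¹ : (Module.End F V)ˣ) : Module.End F V)) :
    ∃! ρ : Uq F q →ₐ[F] Module.End F V, IsChevalleyAction q ψ R K ρ := by
  let g : Chevalley → Module.End F V := fun x => match x with
    | .e => (q - q⁻¹)⁻¹ • ψ
    | .f => (q - q⁻¹)⁻¹ • R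
    | .k => K
    | .kinv => ((K⁻¹ : (Module.End F V)ˣ) : Module.End F V)
  have hrel : ∀ ⦃x y : FreeAlgebra F Chevalley⦄, UqRel F q x y →
      FreeAlgebra.lift F g x = FreeAlgebra.lift F g y := by
    intro x y hxy
    cases hxy with
    | k_kinv => simp [g]
    | kinv_k => simp [g]
    | k_e =>
      simp only [map_mul, map_smul, FreeAlgebra.lift_ι_apply, g, mul_smul_comm, smul_mul_assoc,
        h.lower]
      rw [mul_assoc, h.mul_inv, mul_one, smul_comm]
    | k_f =>
      simp only [map_mul, map_smul, FreeAlgebra.lift_ι_apply, g, mul_smul_comm, smul_mul_assoc,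
        h.raise]
      rw [mul_assoc, h.mul_inv, mul_one, smul_comm]
    | e_f =>
      simp only [map_mul, map_smul, map_sub, FreeAlgebra.lift_ι_apply, g, mul_smul_comm,
        smul_mul_assoc]
      rw [← smul_sub, ← smul_sub, h.comm, inv_smul_smul₀ hqq]
  refine ⟨RingQuot.liftAlgHom F ⟨FreeAlgebra.lift F g, fun {x y} => @hrel x y⟩, ?_, ?_⟩
  · constructor <;>
      simp [gen, g, RingQuot.liftAlgHom_mkAlgHom_apply]
  · intro ρ hρ
    refine RingQuot.ringQuot_ext' F _ _ (FreeAlgebra.hom_ext (funext fun x => ?_))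
    have hx : ρ (gen q x) = g x := by
      cases x
      exacts [hρ.e, hρ.f, hρ.k, hρ.kinv]
    simpa [gen, RingQuot.liftAlgHom_mkAlgHom_apply] using hx

theorem IsChevalleyAction.map_casimir (hqq : q - q⁻¹ ≠ 0) {ρ : Uq F q →ₐ[F] Module.End F V}
    (h : IsChevalleyAction q ψ R K ρ) :
    ρ (casimir q) = ψ * R + q⁻¹ • (K : Module.End F V) +
      q • ((K⁻¹ : (Module.End F V)ˣ) : Module.End F V) := by
  simp only [casimir, map_add, map_smul, map_mul, h.e, h.f, h.k, h.kinv, smul_mul_assoc,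
    mul_smul_comm, smul_smul]
  rw [show (q - q⁻¹) ^ 2 * ((q - q⁻¹)⁻¹ * (q - q⁻¹)⁻¹) = 1 by
    rw [← mul_inv, ← pow_two, mul_inv_cancel₀ (pow_ne_zero 2 hqq)], one_smul]

end Modules

/-! ### Tridiagonal systems of `q`-Racah type -/

section QRacah

variable {F V : Type*} [Field F] [AddCommGroup V] [Module F V] {d : ℕ}

/-- The `q`-Racah eigenvalue sequence `a q ^ (d - 2 j) + a⁻¹ q ^ (2 j - d)`. -/
def qRacahEigenvalue (q a : F) (d j : ℕ) : F :=
  a * q ^ ((d : ℤ) - 2 * (j : ℕ)) + a⁻¹ * q ^ (2 * ((j : ℕ) : ℤ) - d)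

theorem iSup_fin_eq_eigSup {A : Module.End F V} {E : Fin (d + 1) → Module.End F V}
    {θ : ℕ → F} (hE : ∀ i : Fin (d + 1), LinearMap.range (E i) = A.eigenspace (θ i))
    {p : Fin (d + 1) → Prop} {S : Finset ℕ} (hS : S ⊆ Finset.range (d + 1))
    (hp : ∀ j : Fin (d + 1), (j : ℕ) ∈ S ↔ p j) :
    ⨆ (j : Fin (d + 1)) (_ : p j), LinearMap.range (E j) = eigSup A θ S := by
  refine le_antisymm (iSup₂_le fun j hj => ?_) (iSup₂_le fun j hj => ?_)
  · rw [hE]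
    exact eigenspace_le_eigSup ((hp j).2 hj)
  · have hlt := Finset.mem_range.1 (hS hj)
    refine le_iSup₂_of_le (f := fun (j : Fin (d + 1)) (_ : p j) => LinearMap.range (E j))
      ⟨j, hlt⟩ ((hp ⟨j, hlt⟩).1 hj) ?_
    rw [hE]

theorem iSup_eq_top_of_isEigenspaceOrdering {A : Module.End F V}
    {W : Fin (d + 1) → Submodule F V} (hA : IsDiagonalizable A)
    (hW : IsEigenspaceOrdering A W) : ⨆ i, W i = ⊤ := by
  refine top_unique (hA ▸ iSup_le fun μ => ?_)
  by_cases hμ : A.eigenspace μ = ⊥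
  · rw [hμ]
    exact bot_le
  · obtain ⟨i, hi⟩ := (hW.2 (A.eigenspace μ)).2 ⟨μ, hμ, rfl⟩
    exact hi ▸ le_iSup W i

theorem range_eq_of_isStandardIdempotents {A : Module.End F V}
    {E : Fin (d + 1) → Module.End F V} {W : Fin (d + 1) → Submodule F V}
    (hA : IsDiagonalizable A) (hW : IsEigenspaceOrdering A W)
    (hE : ∀ i, (∀ v ∈ W i, E i v = v) ∧ ∀ j, j ≠ i → ∀ v ∈ W j, E i v = 0) (i : Fin (d + 1)) :
    LinearMap.range (E i) = W i := by
  refine le_antisymm ?_ fun v hv => ⟨v, (hE i).1 v hv⟩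
  have htop : ⊤ ≤ (W i).comap (E i) := by
    rw [← iSup_eq_top_of_isEigenspaceOrdering hA hW]
    refine iSup_le fun j v hv => ?_
    rw [Submodule.mem_comap]
    by_cases hj : j = i
    · subst hj
      rwa [(hE j).1 v hv]
    · rw [(hE i).2 j hj v hv]
      exact zero_mem _
  rintro _ ⟨v, rfl⟩
  exact htop Submodule.mem_top

theorem IsStandardIdempotents.eigenvalue_facts {A C : Module.End F V}
    {E : Fin (d + 1) → Module.End F V} (hA : IsDiagonalizable A)
    (h : IsStandardIdempotents A C E) {θ : ℕ → F}
    (hθ : ∀ i : Fin (d + 1), LinearMap.range (E i) = A.eigenspace (θ i)) :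
    Set.InjOn θ (Finset.range (d + 1)) ∧ eigSup A θ (Finset.range (d + 1)) = ⊤ ∧
    (∀ i ≤ d, ∀ v ∈ A.eigenspace (θ i),
      C v ∈ eigSup A θ ((Finset.range (d + 1)).filter fun j => j ≤ i + 1 ∧ i ≤ j + 1)) ∧
    ∀ i ≤ d, A.eigenspace (θ i) ≠ ⊥ := by
  obtain ⟨W, ⟨hW, htri⟩, hE⟩ := h
  have hWE := range_eq_of_isStandardIdempotents hA hW hE
  have hWθ : ∀ i (hi : i < d + 1), W ⟨i, hi⟩ = A.eigenspace (θ i) := fun i hi => by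
    rw [← hWE, hθ]
  refine ⟨fun i hi j hj hij => ?_, ?_, fun i hi v hv => ?_, fun i hi h0 => ?_⟩
  · simp only [Finset.coe_range, Set.mem_Iio] at hi hj
    have := hW.1 ((hWθ i hi).trans ((congrArg A.eigenspace hij).trans (hWθ j hj).symm))
    simpa using this
  · rw [eq_top_iff, ← iSup_eq_top_of_isEigenspaceOrdering hA hW]
    refine iSup_le fun j => ?_
    rw [hWθ j j.isLt]
    exact eigenspace_le_eigSup (Finset.mem_range.2 j.isLt)
  · have hi' : i < d + 1 := by omega
    have h1 := htri ⟨i, hi'⟩ (Submodule.mem_map_of_mem ((hWθ i hi').symm ▸ hv))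
    simp only [← hWE] at h1
    rwa [iSup_fin_eq_eigSup hθ (Finset.filter_subset (fun j => j ≤ i + 1 ∧ i ≤ j + 1) _)
      fun j => ?_] at h1
    simp only [Finset.mem_filter, Finset.mem_range, j.isLt, true_and]
  · have hi' : i < d + 1 := by omega
    obtain ⟨μ, hμ, hWμ⟩ := (hW.2 (W ⟨i, hi'⟩)).1 ⟨_, rfl⟩
    exact hμ (hWμ.symm.trans ((hWθ i hi').trans h0))

theorem TDSystem.IsQRacah.isTD {Φ : TDSystem F V d} {q a b : F} (h : Φ.IsQRacah q a b) :
    IsTD Φ.A Φ.Astar d (qRacahEigenvalue q a d) (qRacahEigenvalue q b d) := by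
  obtain ⟨h1, h2, h3, h4⟩ := Φ.standard.eigenvalue_facts Φ.isTridiagonalPair.diag
    (θ := qRacahEigenvalue q a d) h.eigenvalue
  obtain ⟨h5, h6, h7, h8⟩ := Φ.standard_star.eigenvalue_facts Φ.isTridiagonalPair.diag_star
    (θ := qRacahEigenvalue q b d) h.eigenvalue_star
  exact ⟨h1, h5, h2, h6, h3, h7, h4, h8, Φ.isTridiagonalPair.irreducible⟩

theorem TDSystem.IsQRacah.secondInversion {Φ : TDSystem F V d} {q a b : F}
    (h : Φ.IsQRacah q a b) : Φ.secondInversion.IsQRacah q a⁻¹ b where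
  q_ne_zero := h.q_ne_zero
  a_ne_zero := inv_ne_zero h.a_ne_zero
  b_ne_zero := h.b_ne_zero
  q_pow_four_ne_one := h.q_pow_four_ne_one
  eigenvalue i := by
    have hi : ((i.rev : ℕ) : ℤ) = d - i := by
      have := i.isLt
      rw [Fin.val_rev]
      omega
    refine (h.eigenvalue i.rev).trans ?_
    change Φ.A.eigenspace _ = Φ.A.eigenspace _
    rw [hi, inv_inv, add_comm, show (2 : ℤ) * (d - i) - d = d - 2 * i by ring,
      show (d : ℤ) - 2 * (d - i) = 2 * i - d by ring]
  eigenvalue_star := h.eigenvalue_star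

namespace TDSystem

variable {Φ : TDSystem F V d} {q a b : F}

theorem IsQRacah.sub_inv_ne_zero (h : Φ.IsQRacah q a b) : q - q⁻¹ ≠ 0 := by
  intro h0
  have hq := h.q_ne_zero
  field_simp at h0
  exact h.q_pow_four_ne_one (by linear_combination (q ^ 2 + 1) * h0)

theorem highest_secondInversion (i : Fin (d + 1)) :
    Φ.secondInversion.highest i = Φ.highest i := by
  unfold highest
  congr 1
  refine Equiv.iSup_congr Fin.revPerm fun j => iSup_congr_Prop ?_ fun _ => rfl
  simp only [Fin.revPerm_apply, Fin.le_def, Fin.val_rev]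
  have := i.isLt
  have := j.isLt
  omega

/-- The split decomposition of `Φ`, indexed by the natural numbers. -/
abbrev split (Φ : TDSystem F V d) (q a b : F) : ℕ → Submodule F V :=
  splitU Φ.A Φ.Astar d (qRacahEigenvalue q a d) (qRacahEigenvalue q b d)

namespace IsQRacah

theorem U_eq (h : Φ.IsQRacah q a b) (i : Fin (d + 1)) : Φ.U i = Φ.split q a b i := by
  have hi := i.isLt
  unfold U split splitU lowerFlag upperFlag
  rw [iSup_fin_eq_eigSup (θ := qRacahEigenvalue q b d) (S := Finset.range (i + 1))
      h.eigenvalue_star (Finset.range_subset_range.2 (by omega)),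
    iSup_fin_eq_eigSup (θ := qRacahEigenvalue q a d) (S := Finset.Icc i d) h.eigenvalue]
  · intro j hj
    simp only [Finset.mem_Icc, Finset.mem_range] at hj ⊢
    omega
  · intro j
    have := j.isLt
    simp only [Finset.mem_Icc, Fin.le_def]
    omega
  · intro j
    simp only [Finset.mem_range, Fin.le_def]
    omega

theorem highest_eq (h : Φ.IsQRacah q a b) (i : Fin (d + 1)) : Φ.highest i =
    lowerFlag Φ.Astar (qRacahEigenvalue q b d) (i + 1) ⊓
      eigSup Φ.A (qRacahEigenvalue q a d) (Finset.Icc i (d - i)) := by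
  have hi := i.isLt
  unfold highest lowerFlag
  rw [iSup_fin_eq_eigSup (θ := qRacahEigenvalue q b d) (S := Finset.range (i + 1))
      h.eigenvalue_star (Finset.range_subset_range.2 (by omega)),
    iSup_fin_eq_eigSup (θ := qRacahEigenvalue q a d) (S := Finset.Icc i (d - i)) h.eigenvalue]
  · intro j hj
    simp only [Finset.mem_Icc, Finset.mem_range] at hj ⊢
    omega
  · intro j
    have := j.isLt
    simp only [Finset.mem_Icc, Fin.le_def, Fin.val_rev]
    omega
  · intro j
    simp only [Finset.mem_range, Fin.le_def]
    omega

theorem isSplitMap_iff (h : Φ.IsQRacah q a b) (K : (Module.End F V)ˣ) :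
    Φ.IsSplitMap q K ↔ ∀ k : ℕ, ∀ v ∈ Φ.split q a b k,
      (K : Module.End F V) v = q ^ ((d : ℤ) - 2 * k) • v := by
  constructor
  · intro hK k v hv
    rcases lt_or_ge d k with hk | hk
    · rw [split, splitU_eq_bot hk, Submodule.mem_bot] at hv
      simp [hv]
    · exact hK ⟨k, by omega⟩ v (by rwa [h.U_eq])
  · intro hK i v hv
    exact hK i v (by rwa [← h.U_eq])

theorem existsUnique_splitMap (h : Φ.IsQRacah q a b) :
    ∃! K : (Module.End F V)ˣ, Φ.IsSplitMap q K := by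
  have hi := h.isTD.iSupIndep_splitU
  have hs := h.isTD.iSup_splitU
  obtain ⟨K, hK⟩ := exists_end_smul hi hs fun k => q ^ ((d : ℤ) - 2 * (k : ℕ))
  obtain ⟨K', hK'⟩ := exists_end_smul hi hs fun k => (q ^ ((d : ℤ) - 2 * (k : ℕ)))⁻¹
  have hne : ∀ k : ℕ, q ^ ((d : ℤ) - 2 * k) ≠ 0 := fun k => zpow_ne_zero _ h.q_ne_zero
  refine ⟨⟨K, K', ?_, ?_⟩, (h.isSplitMap_iff _).2 hK, fun L hL => Units.ext ?_⟩
  · refine ext_of_iSup_eq_top hs fun k v hv => ?_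
    simp [hK k v hv, hK' k v hv, smul_smul, hne k]
  · refine ext_of_iSup_eq_top hs fun k v hv => ?_
    simp [hK k v hv, hK' k v hv, smul_smul, hne k]
  · refine ext_of_iSup_eq_top hs fun k v hv => ?_
    rw [(h.isSplitMap_iff L).1 hL k v hv]
    exact (hK k v hv).symm

variable {K : (Module.End F V)ˣ}

theorem zpow_weight_add_two (hq : q ≠ 0) (k : ℕ) :
    q ^ ((d : ℤ) - 2 * k + 2) = q ^ 2 * q ^ ((d : ℤ) - 2 * k) := by
  rw [zpow_add₀ hq, mul_comm, zpow_ofNat]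

theorem zpow_weight_succ (hq : q ≠ 0) (k : ℕ) :
    q ^ ((d : ℤ) - 2 * (k + 1 : ℕ)) = (q ^ 2)⁻¹ * q ^ ((d : ℤ) - 2 * k) := by
  rw [eq_inv_mul_iff_mul_eq₀ (pow_ne_zero 2 hq), ← zpow_weight_add_two hq]
  congr 1
  push_cast
  ring

theorem inv_splitMap_apply (h : Φ.IsQRacah q a b) (hK : Φ.IsSplitMap q K) {k : ℕ} {v : V}
    (hv : v ∈ Φ.split q a b k) :
    ((K⁻¹ : (Module.End F V)ˣ) : Module.End F V) v = q ^ (2 * (k : ℤ) - d) • v := by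
  have h1 : ((K⁻¹ : (Module.End F V)ˣ) : Module.End F V) ((K : Module.End F V) v) = v := by
    rw [← Module.End.mul_apply, Units.inv_mul, Module.End.one_apply]
  rw [(h.isSplitMap_iff K).1 hK k v hv, map_smul] at h1
  rw [show 2 * (k : ℤ) - d = -((d : ℤ) - 2 * k) by ring, zpow_neg]
  exact (eq_inv_smul_iff₀ (zpow_ne_zero _ h.q_ne_zero)).2 h1

theorem raising_apply (h : Φ.IsQRacah q a b) (hK : Φ.IsSplitMap q K) :
    ∀ k, ∀ v ∈ Φ.split q a b k,
      Φ.raising a K v = Φ.A v - qRacahEigenvalue q a d k • v := by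
  intro k v hv
  simp only [raising, LinearMap.sub_apply, LinearMap.smul_apply,
    (h.isSplitMap_iff K).1 hK k v hv, h.inv_splitMap_apply hK hv, qRacahEigenvalue]
  module

theorem isLefschetz [FiniteDimensional F V] (h : Φ.IsQRacah q a b) (hK : Φ.IsSplitMap q K) :
    IsLefschetz (Φ.raising a K) d (Φ.split q a b) :=
  h.isTD.isLefschetz (h.raising_apply hK)

theorem primitivePart_eq (h : Φ.IsQRacah q a b) (hK : Φ.IsSplitMap q K) (i : Fin (d + 1))
    (hi : 2 * (i : ℕ) ≤ d) :
    primitivePart (Φ.raising a K) d (Φ.split q a b) i = Φ.highest i := by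
  rw [h.isTD.primitivePart_eq (h.raising_apply hK) hi, h.highest_eq]

/-- The scalar by which the commutator of `ψ` and the raising map acts on the component of
degree `k`. -/
def commScalar (q : F) (d k : ℕ) : F :=
  (q - q⁻¹) * (q ^ ((d : ℤ) - 2 * k) - q ^ (2 * (k : ℤ) - d))

theorem sum_commScalar (q : F) {i : ℕ} (hi : 2 * i ≤ d) :
    ∑ m ∈ Finset.range (d - 2 * i + 1), commScalar q d (i + m) = 0 := by
  simp only [commScalar]
  rw [← Finset.mul_sum, Finset.sum_sub_distrib,
    ← Finset.sum_range_reflect fun m => q ^ ((d : ℤ) - 2 * (i + m : ℕ))]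
  refine mul_eq_zero_of_right _ (sub_eq_zero.2 (Finset.sum_congr rfl fun m hm => ?_))
  have := Finset.mem_range.1 hm
  congr 1
  omega

theorem isDoubleLowering_iff [FiniteDimensional F V] (h : Φ.IsQRacah q a b)
    (hK : Φ.IsSplitMap q K) (ψ : Module.End F V) :
    Φ.IsDoubleLowering q a K ψ ↔
      (∀ k, ∀ v ∈ Φ.split q a b k,
        ψ (Φ.raising a K v) - Φ.raising a K (ψ v) = commScalar q d k • v) ∧
      ∀ i, 2 * i ≤ d → ∀ v ∈ primitivePart (Φ.raising a K) d (Φ.split q a b) i, ψ v = 0 := by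
  have hc : ∀ k, ∀ v ∈ Φ.split q a b k, ((q - q⁻¹) • ((K : Module.End F V) -
      ((K⁻¹ : (Module.End F V)ˣ) : Module.End F V))) v = commScalar q d k • v := by
    intro k v hv
    simp only [LinearMap.sub_apply, LinearMap.smul_apply, (h.isSplitMap_iff K).1 hK k v hv,
      h.inv_splitMap_apply hK hv, commScalar]
    module
  refine and_congr ⟨fun h1 k v hv => ?_, fun h1 => ?_⟩ ⟨fun h1 i hi v hv => ?_,
    fun h1 i hi v hv => ?_⟩
  · rw [← hc k v hv, ← h1]
    rfl
  · refine ext_of_iSup_eq_top h.isTD.iSup_splitU fun k v hv => ?_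
    rw [hc k v hv, ← h1 k v hv]
    rfl
  · exact h1 ⟨i, by omega⟩ hi v (by rwa [← h.primitivePart_eq hK ⟨i, by omega⟩ hi])
  · exact h1 i hi v (by rwa [h.primitivePart_eq hK i hi])

theorem existsUnique_doubleLowering [FiniteDimensional F V] (h : Φ.IsQRacah q a b)
    (hK : Φ.IsSplitMap q K) : ∃! ψ : Module.End F V, Φ.IsDoubleLowering q a K ψ := by
  have hL := h.isLefschetz hK
  obtain ⟨ψ, hψ⟩ := hL.exists_lowering (commScalar q d) fun i hi => sum_commScalar q hi
  refine ⟨ψ, (h.isDoubleLowering_iff hK ψ).2 hψ, fun ψ' hψ' => ?_⟩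
  replace hψ' := (h.isDoubleLowering_iff hK ψ').1 hψ'
  refine ext_of_iSup_eq_top hL.span fun k => hL.le_of_raise (S := fun _ => LinearMap.eqLocus ψ' ψ)
    (fun i hi v hv => ?_) (fun k v hv h0 => ?_) k
  · exact (hψ'.2 i hi v hv).trans (hψ.2 i hi v hv).symm
  · have h1 : ψ' v = ψ v := h0
    have h2 := (hψ'.1 k v hv).trans (hψ.1 k v hv).symm
    rw [h1] at h2
    exact sub_left_injective h2

variable {ψ : Module.End F V}

theorem uqTriple [FiniteDimensional F V] (h : Φ.IsQRacah q a b) (hK : Φ.IsSplitMap q K)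
    (hψ : Φ.IsDoubleLowering q a K ψ) :
    UqTriple q ψ (Φ.raising a K) (K : Module.End F V)
      ((K⁻¹ : (Module.End F V)ˣ) : Module.End F V) := by
  have hL := h.isLefschetz hK
  have hKU := (h.isSplitMap_iff K).1 hK
  have hψ' := (h.isDoubleLowering_iff hK ψ).1 hψ
  have hq := h.q_ne_zero
  have hKR : (K : Module.End F V) * Φ.raising a K =
      (q ^ 2)⁻¹ • (Φ.raising a K * (K : Module.End F V)) := by
    refine ext_of_iSup_eq_top hL.span fun k v hv => ?_
    simp only [Module.End.mul_apply, LinearMap.smul_apply, hKU k v hv, map_smul, smul_smul,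
      hKU (k + 1) _ (hL.raise k v hv)]
    rw [zpow_weight_succ hq]
  refine ⟨K.mul_inv, K.inv_mul, ?_, hKR, hψ.1⟩
  have key : ∀ k, Φ.split q a b k ≤
      LinearMap.ker ((K : Module.End F V) * ψ - q ^ ((d : ℤ) - 2 * k + 2) • ψ) := by
    refine hL.le_of_raise (fun i hi v hv => ?_) fun k v hv h0 => ?_
    · simp [hψ'.2 i hi v hv]
    · have h1 : (K : Module.End F V) (ψ v) = q ^ ((d : ℤ) - 2 * k + 2) • ψ v :=
        sub_eq_zero.1 (by simpa using h0)
      have h2 : ψ (Φ.raising a K v) = Φ.raising a K (ψ v) + commScalar q d k • v :=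
        sub_eq_iff_eq_add'.1 (hψ'.1 k v hv)
      have h3 : (K : Module.End F V) (Φ.raising a K (ψ v)) =
          q ^ ((d : ℤ) - 2 * k) • Φ.raising a K (ψ v) := by
        have := LinearMap.congr_fun hKR (ψ v)
        simp only [Module.End.mul_apply, LinearMap.smul_apply, h1, map_smul, smul_smul] at this
        rw [this, zpow_weight_add_two hq, inv_mul_cancel_left₀ (pow_ne_zero 2 hq)]
      rw [LinearMap.mem_ker, LinearMap.sub_apply, Module.End.mul_apply, LinearMap.smul_apply, h2,
        map_add, map_smul, h3, hKU k v hv, Nat.cast_add, Nat.cast_one,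
        show (d : ℤ) - 2 * (k + 1) + 2 = d - 2 * k by ring]
      module
  refine ext_of_iSup_eq_top hL.span fun k v hv => ?_
  have h1 := key k hv
  simp only [LinearMap.mem_ker, LinearMap.sub_apply, Module.End.mul_apply,
    LinearMap.smul_apply, sub_eq_zero] at h1
  simp only [Module.End.mul_apply, LinearMap.smul_apply, h1, hKU k v hv, map_smul, smul_smul]
  rw [zpow_weight_add_two hq]

/-- `ψ` sends each component of the split decomposition to the previous one, and kills the one of
degree `0`. The commutation relation of `ψ` with `K` alone would not give the latter, since
`q ^ (2 * (d + 1)) = 1` is possible. -/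
theorem isNilpotent_doubleLowering [FiniteDimensional F V] (h : Φ.IsQRacah q a b)
    (hK : Φ.IsSplitMap q K) (hψ : Φ.IsDoubleLowering q a K ψ) : IsNilpotent ψ := by
  have hL := h.isLefschetz hK
  have hψ' := (h.isDoubleLowering_iff hK ψ).1 hψ
  let S : ℕ → Submodule F V := fun k => match k with
    | 0 => ⊥
    | k + 1 => Φ.split q a b k
  have hS : ∀ k, Φ.split q a b k ≤ (S k).comap ψ := by
    refine hL.le_of_raise (fun i hi v hv => ?_) fun k v hv h0 => ?_
    · rw [Submodule.mem_comap, hψ'.2 i hi v hv]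
      exact zero_mem _
    · have h2 : ψ (Φ.raising a K v) = Φ.raising a K (ψ v) + commScalar q d k • v :=
        sub_eq_iff_eq_add'.1 (hψ'.1 k v hv)
      rw [Submodule.mem_comap, h2]
      refine add_mem ?_ (Submodule.smul_mem _ _ hv)
      cases k with
      | zero =>
        have h3 : ψ v = 0 := (Submodule.mem_bot F).1 h0
        rw [h3, map_zero]
        exact zero_mem _
      | succ k => exact hL.raise k _ h0
  have hpow : ∀ k, ∀ v ∈ Φ.split q a b k, (ψ ^ (k + 1)) v = 0 := by
    intro k
    induction k with
    | zero => intro v hv; simpa using (Submodule.mem_bot F).1 (hS 0 hv)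
    | succ k ih =>
      intro v hv
      rw [pow_succ, Module.End.mul_apply]
      exact ih _ (hS (k + 1) hv)
  refine ⟨d + 1, ext_of_iSup_eq_top hL.span fun k v hv => ?_⟩
  rcases lt_or_ge d k with hk | hk
  · rw [hL.eq_bot k hk, Submodule.mem_bot] at hv
    simp [hv]
  · rw [show d + 1 = d - k + (k + 1) by omega, pow_add, Module.End.mul_apply, hpow k v hv]
    simp

theorem raising_add (K : (Module.End F V)ˣ) : Φ.A = Φ.raising a K +
    a • (K : Module.End F V) + a⁻¹ • ((K⁻¹ : (Module.End F V)ˣ) : Module.End F V) := by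
  unfold raising
  abel

theorem raising_secondInversion (B : (Module.End F V)ˣ) :
    Φ.secondInversion.raising a⁻¹ B = Φ.A - a⁻¹ • (B : Module.End F V) -
      a • ((B⁻¹ : (Module.End F V)ˣ) : Module.End F V) := by
  rw [raising, inv_inv]
  rfl

/-- The split map `B` of the second inversion satisfies `(1 - a⁻¹ q ψ) B = (1 - a q ψ) K`: the
solution of this equation agrees with `B` on the primitive parts, which `Φ` and its second
inversion share, and it has the commutation relation with `A` needed to propagate the agreement
along the raising map. -/
theorem weightLink [FiniteDimensional F V] (h : Φ.IsQRacah q a b) (hK : Φ.IsSplitMap q K)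
    (hψ : Φ.IsDoubleLowering q a K ψ) {B : (Module.End F V)ˣ}
    (hB : Φ.secondInversion.IsSplitMap q B) :
    WeightLink q a ψ (K : Module.End F V) B ((B⁻¹ : (Module.End F V)ˣ) : Module.End F V) := by
  have hq := h.q_ne_zero
  have ha := h.a_ne_zero
  have hnil := h.isNilpotent_doubleLowering hK hψ
  obtain ⟨P, hP⟩ := (hnil.smul (a⁻¹ * q)).isUnit_one_sub
  obtain ⟨Q, hQ⟩ := (hnil.smul (a * q)).isUnit_one_sub
  have hcancel : ∀ x y : Module.End F V,
      (1 - (a⁻¹ * q) • ψ) * x = (1 - (a⁻¹ * q) • ψ) * y → x = y := fun x y hxy =>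
    P.isUnit.mul_left_cancel (by rwa [hP])
  -- `B₀` is the solution of the linking equation, to be identified with `B`.
  let B₀ : (Module.End F V)ˣ := P⁻¹ * (Q * K)
  have hB₀ : WeightLink q a ψ (K : Module.End F V) (B₀ : Module.End F V)
      ((B₀⁻¹ : (Module.End F V)ˣ) : Module.End F V) := by
    refine ⟨B₀.mul_inv, B₀.inv_mul, hcancel, ?_⟩
    rw [← hP, ← hQ, ← Units.val_mul, ← Units.val_mul]
    simp [B₀]
  have h' := h.secondInversion
  have hL := h'.isLefschetz hB
  have hBU := (h'.isSplitMap_iff B).1 hB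
  have hcomm := hB₀.weight_comm_apply hq ha (h.uqTriple hK hψ) (raising_add K)
  have key : ∀ k, Φ.secondInversion.split q a⁻¹ b k ≤
      LinearMap.ker ((B₀ : Module.End F V) - q ^ ((d : ℤ) - 2 * k) • (1 : Module.End F V)) := by
    refine hL.le_of_raise (fun i hi v hv => ?_) fun k v hv h0 => ?_
    · have hi' : i < d + 1 := by omega
      rw [h'.primitivePart_eq hB ⟨i, hi'⟩ hi, highest_secondInversion,
        ← h.primitivePart_eq hK ⟨i, hi'⟩ hi] at hv
      have hψv := ((h.isDoubleLowering_iff hK ψ).1 hψ).2 i hi v hv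
      have hKv := (h.isSplitMap_iff K).1 hK i v hv.1
      have hPv : (P : Module.End F V) v = v := by simp [hP, hψv]
      have hQv : (Q : Module.End F V) v = v := by simp [hQ, hψv]
      have hPv' : ((P⁻¹ : (Module.End F V)ˣ) : Module.End F V) v = v := by
        conv_lhs => rw [← hPv]
        rw [← Module.End.mul_apply, Units.inv_mul, Module.End.one_apply]
      simp [B₀, hKv, hQv, hPv']
    · have h1 : (B₀ : Module.End F V) v = q ^ ((d : ℤ) - 2 * k) • v :=
        sub_eq_zero.1 (by simpa using h0)
      have h2 := LinearMap.congr_fun hcomm v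
      have hne : q ^ ((d : ℤ) - 2 * k) ≠ 0 := zpow_ne_zero _ hq
      have hexp' : q ^ (2 * (k : ℤ) - d) = (q ^ ((d : ℤ) - 2 * k))⁻¹ := by
        rw [← zpow_neg]
        congr 1
        ring
      have hA : Φ.secondInversion.A = Φ.A := rfl
      rw [LinearMap.mem_ker, h'.raising_apply hB k v hv, hA, qRacahEigenvalue, hexp', inv_inv]
      simp only [LinearMap.sub_apply, LinearMap.add_apply, LinearMap.smul_apply,
        Module.End.mul_apply, Module.End.one_apply, h1, map_smul, map_sub] at h2 ⊢
      rw [zpow_weight_succ hq]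
      generalize q ^ ((d : ℤ) - 2 * k) = β at *
      linear_combination (norm := skip) q⁻¹ • h2
      match_scalars <;> field_simp <;> ring
  have hBB : B = B₀ := Units.ext (ext_of_iSup_eq_top hL.span fun k v hv => by
    rw [hBU k v hv]
    exact (sub_eq_zero.1 (by simpa using key k hv)).symm)
  rw [hBB]
  exact hB₀

end IsQRacah

end TDSystem

end QRacah

end TDPair

theorem lemma11p1 {F V : Type*} [Field F] [IsAlgClosed F] [AddCommGroup V] [Module F V]
    [FiniteDimensional F V] [Nontrivial V] {d : ℕ} (hd : 1 ≤ d)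
    (Φ : TDPair.TDSystem F V d) (q a b : F) (hΦ : Φ.IsQRacah q a b) :
    -- `K` and `B` are well defined
    (∃! K : (Module.End F V)ˣ, Φ.IsSplitMap q K) ∧
    (∃! B : (Module.End F V)ˣ, Φ.secondInversion.IsSplitMap q B) ∧
    ∀ K B : (Module.End F V)ˣ, Φ.IsSplitMap q K → Φ.secondInversion.IsSplitMap q B →
      -- `ψ` is well defined
      (∃! ψ : Module.End F V, Φ.IsDoubleLowering q a K ψ) ∧
      ∀ ψ : Module.End F V, Φ.IsDoubleLowering q a K ψ →
        -- both module structures exist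
        (∃! ρ : TDPair.Uq F q →ₐ[F] Module.End F V,
          TDPair.IsChevalleyAction q ψ (Φ.raising a K) K ρ) ∧
        (∃! ρ' : TDPair.Uq F q →ₐ[F] Module.End F V,
          TDPair.IsChevalleyAction q ψ (Φ.secondInversion.raising a⁻¹ B) B ρ') ∧
        ∀ ρ ρ' : TDPair.Uq F q →ₐ[F] Module.End F V,
          TDPair.IsChevalleyAction q ψ (Φ.raising a K) K ρ →
          TDPair.IsChevalleyAction q ψ (Φ.secondInversion.raising a⁻¹ B) B ρ' →
          ∃ Λ : Module.End F V,
            -- `Λ` is the common action of the Casimir element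
            Λ = ρ (TDPair.casimir q) ∧ Λ = ρ' (TDPair.casimir q) ∧
            Φ.A ^ 2 * ψ - (q ^ 2 + (q ^ 2)⁻¹) • (Φ.A * ψ * Φ.A) + ψ * Φ.A ^ 2
                + (q ^ 2 - (q ^ 2)⁻¹) ^ 2 • ψ
              = -((q - q⁻¹) ^ 2 • (Λ * Φ.A))
                + ((a + a⁻¹) * (q - q⁻¹) ^ 2 * (q + q⁻¹)) • (1 : Module.End F V) ∧
            ψ ^ 2 * Φ.A - (q ^ 2 + (q ^ 2)⁻¹) • (ψ * Φ.A * ψ) + Φ.A * ψ ^ 2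
              = -((q - q⁻¹) ^ 2 • (Λ * ψ)) := by
  have hq := hΦ.q_ne_zero
  have ha := hΦ.a_ne_zero
  have hqq := hΦ.sub_inv_ne_zero
  refine ⟨hΦ.existsUnique_splitMap, hΦ.secondInversion.existsUnique_splitMap,
    fun K B hK hB => ⟨hΦ.existsUnique_doubleLowering hK, fun ψ hψ => ?_⟩⟩
  have hU := hΦ.uqTriple hK hψ
  have hA := TDPair.TDSystem.IsQRacah.raising_add (Φ := Φ) (a := a) K
  have hlink := hΦ.weightLink hK hψ hB
  have hU' := hlink.uqTriple hq ha hU hA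
  rw [← TDPair.TDSystem.IsQRacah.raising_secondInversion] at hU'
  refine ⟨hU.existsUnique_chevalleyAction hqq, hU'.existsUnique_chevalleyAction hqq,
    fun ρ ρ' hρ hρ' => ⟨ρ (TDPair.casimir q), rfl, ?_, ?_, ?_⟩⟩
  · rw [hρ.map_casimir hqq, hρ'.map_casimir hqq,
      TDPair.TDSystem.IsQRacah.raising_secondInversion]
    exact hlink.casimir_eq hq ha hU hA
  · rw [hρ.map_casimir hqq]
    exact hU.casimir_relation hq ha hA
  · rw [hρ.map_casimir hqq]
    exact hU.casimir_relation_lower hq ha hA
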